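/- Let $d\in\{1,2,3\}$, $N\ge 1$, and let $\mathcal W\in L^1_{\mathrm{loc}}(\mathbb R^{dN};\mathbb R_+)$. Write $\mathbf X=(\mathbf x_1,\dots,\mathbf x_N)\in\mathbb R^{dN}$. Let $\mathfrak h$ be a separable complex Hilbert space and $\omega\ge 0$ an injective self-adjoint, possibly unbounded, operator on $\mathfrak h$. Let $\mathfrak h_\omega$ be the Hilbert completion of $\bigcap_{k}\mathscr D(\omega^k)$ for the scalar product $\langle x|\omega|y\rangle_{\mathfrak h}$; for $z\in\mathfrak h_\omega$ and $v\in\mathscr D(\omega^{-1/2})$ set $\langle z|v\rangle:=\langle\omega^{1/2}z|\omega^{-1/2}v\rangle_{\mathfrak h}$ and $\langle z|\omega|z\rangle:=\|z\|^2_{\mathfrak h_\omega}$. Consider one of the following quasi-classical Hamiltonians $\mathcal H_z$ on $L^2(\mathbb R^{dN})$: (a) (Nelson) $\mathcal H_z=\sum_{j}\bigl(-\Delta_j+2\Re\langle z|\lambda(\mathbf x_j)\rangle\bigr)+\mathcal W+\langle z|\omega|z\rangle$, where $z\in\mathfrak h_\omega$ and $\lambda,\omega^{-1/2}\lambda\in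 L^\infty(\mathbb R^d;\mathfrak h)$; (b) (Fröhlich polaron) $\mathfrak h=\mathfrak h_\omega=L^2(\mathbb R^d)$, $\omega=1$, $\mathcal H_z=\sum_j\bigl(-\Delta_j+\mathcal V_z(\mathbf x_j)\bigr)+\mathcal W+\|z\|^2$, where $\alpha>0$ and $\mathcal V_z(\mathbf x)=2\sqrt\alpha\,\Re\int\overline{z(\mathbf k)}\,|\mathbf k|^{-\frac{d-1}{2}}e^{-i\mathbf k\cdot\mathbf x}\,d\mathbf k$ is understood as the form $\sqrt\alpha\,(\mathcal V_{<,z}+\nabla\cdot\mathbf G_z)$ for a cut-off $\varrho>0$, with the bounded functions $\mathcal V_{<,z}(\mathbf x)=2\Re\int_{|\mathbf k|\le\varrho}\overline{z(\mathbf k)}|\mathbf k|^{-\frac{d-1}{2}}e^{-i\mathbf k\cdot\mathbf x}d\mathbf k$ and $\mathbf G_z(\mathbf x)=2\Re\int_{|\mathbf k|>\varrho}\overline{z(\mathbf k)}\,\tfrac{i\mathbf k}{|\mathbf k|}|\mathbf k|^{-\frac{d+1}{2}}e^{-i\mathbf k\cdot\mathbf x}d\mathbf k$, i.e. $\langle\psi|(\nabla\cdot\mathbf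 G_z)(\mathbf x_j)|\psi\rangle:=-2\Re\int\overline\psi\,\mathbf G_z(\mathbf x_j)\cdot\nabla_j\psi\,d\mathbf X$; (c) (Pauli–Fierz) $d=3$, $\mathcal H_z=\sum_j\frac1{2m_j}\bigl(-i\nabla_j+e\,\mathbf a_{z,j}(\mathbf x_j)\bigr)^2+\mathcal W+\langle z|\omega|z\rangle$, where $z\in\mathfrak h_\omega$, $m_j>0$, $e\in\mathbb R$, $\mathbf a_{z,j}(\mathbf x)=2\Re\langle z|\boldsymbol\lambda_j(\mathbf x)\rangle$, and $\lambda_{j,\ell},\omega^{-1/2}\lambda_{j,\ell}\in L^\infty(\mathbb R^3;\mathfrak h)$ for the components of $\boldsymbol\lambda_j=(\lambda_{j,1},\lambda_{j,2},\lambda_{j,3})$. Let $\mathcal E_{\mathrm{qc}}[\psi,z]=\langle\psi|\mathcal H_z|\psi\rangle$ be the quadratic form of $\mathcal H_z$, equal to $+\infty$ unless $\psi\in H^1(\mathbb R^{dN})$ and $\int\mathcal W|\psi|^2<\infty$. Define: - the Pekar functional $\mathcal E_{\mathrm{Pekar}}[\psi]$, which in cases (a), (b) is $\inf_{z}\mathcal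 E_{\mathrm{qc}}[\psi,z]$ and in case (c) is $\mathcal E_{\mathrm{qc}}[\psi,z_\psi]$, where $z_\psi$ is the critical point of $z\mapsto\mathcal E_{\mathrm{qc}}[\psi,z]$ (and $+\infty$ if $\psi$ is not in the form domain); - for a state-valued probability measure $\mathfrak m$, i.e. a Borel measure on $\mathfrak h_\omega$ with values in the nonnegative trace class operators on $L^2(\mathbb R^{dN})$, $\sigma$-additive in trace norm and with $\operatorname{tr}\mathfrak m(\mathfrak h_\omega)=1$, with Radon–Nikodým decomposition $d\mathfrak m(z)=\gamma_{\mathfrak m}(z)\,d\mu_{\mathfrak m}(z)$ into a probability measure $\mu_{\mathfrak m}$ and normalized density matrices $\gamma_{\mathfrak m}(z)$, the energy $\mathcal E_{\mathrm{svm}}[\mathfrak m]=\int d\mu_{\mathfrak m}(z)\operatorname{tr}[\gamma_{\mathfrak m}(z)\mathcal H_z]$; - for $\psi\in L^2(\mathbb R^{dN})$ and a Borel probability measure $\mu$ on $\mathfrak h_\omega$, the energy $\mathcal E_{\mathrm{pm}}[\psi,\mu]=\int d\mu(z)\,\mathcal E_{\mathrm{qc}}[\psi,z]$. Each functional is considered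 on the set of arguments with $\|\psi\|_2=1$ (where a wave function occurs) and with finite energy; a minimizer is an element of this set at which the functional equals its infimum over the set. Then, in each of the three models, the following are equivalent: $\mathcal E_{\mathrm{qc}}$ has a minimizer; $\mathcal E_{\mathrm{Pekar}}$ has a minimizer; $\mathcal E_{\mathrm{svm}}$ has a minimizer; $\mathcal E_{\mathrm{pm}}$ has a minimizer. Moreover, every minimizer $\mathfrak m$ of $\mathcal E_{\mathrm{svm}}$ is concentrated on the set of minimizers of $\mathcal E_{\mathrm{qc}}$: for $\mu_{\mathfrak m}$-almost every $z$ and every normalized eigenvector $\psi$ of $\gamma_{\mathfrak m}(z)$ with nonzero eigenvalue, $(\psi,z)$ is a minimizer of $\mathcal E_{\mathrm{qc}}$. -/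

import Mathlib

open MeasureTheory Set Filter Topology
open scoped ENNReal InnerProductSpace

noncomputable section

namespace QuasiClassical

/-! ### The particle space `L²(ℝ^{dN})` and its first order Sobolev space -/

/-- Configurations `X = (x₁, …, x_N)` of `N` particles in `ℝ^d`; the coordinate `(j, l)` is the
`l`-th component of `x_j`. -/
abbrev Config (d N : ℕ) : Type := EuclideanSpace ℝ (Fin N × Fin d)

/-- The position `x_j` of the `j`-th particle. -/
def pos {d N : ℕ} (j : Fin N) (X : Config d N) : EuclideanSpace ℝ (Fin d) :=
  WithLp.toLp 2 (fun l => X (j, l))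

/-- The Hilbert space `L²(ℝ^{dN}; ℂ)`. -/
abbrev Wave (d N : ℕ) : Type := Lp ℂ 2 (volume : Measure (Config d N))

/-- `g` is the weak partial derivative of `ψ` in the coordinate `i`. -/
def IsWeakPartial {d N : ℕ} (i : Fin N × Fin d) (ψ g : Wave d N) : Prop :=
  ∀ φ : Config d N → ℝ, ContDiff ℝ ((⊤ : ℕ∞) : WithTop ℕ∞) φ → HasCompactSupport φ →
    ∫ X, (fderiv ℝ φ X (EuclideanSpace.single i 1)) • ψ X = -∫ X, φ X • g X

/-- `ψ ∈ H¹(ℝ^{dN})`. -/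
def InH1 {d N : ℕ} (ψ : Wave d N) : Prop := ∀ i, ∃ g, IsWeakPartial i ψ g

open Classical in
/-- The weak partial derivative `∂_i ψ` (with value `0` if there is none in `L²`). -/
def weakPartial {d N : ℕ} (i : Fin N × Fin d) (ψ : Wave d N) : Wave d N :=
  if h : ∃ g, IsWeakPartial i ψ g then h.choose else 0

/-- The form domain of `-Δ + W`. -/
def FormDomain {d N : ℕ} (W : Config d N → ℝ) (ψ : Wave d N) : Prop :=
  InH1 ψ ∧ Integrable (fun X => W X * ‖ψ X‖ ^ 2)

/-- `W ∈ L¹_loc(ℝ^{dN}; ℝ₊)`. -/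
def IsPotential {d N : ℕ} (W : Config d N → ℝ) : Prop :=
  LocallyIntegrable W ∧ ∀ᵐ X, 0 ≤ W X

/-- The quadratic form `⟨ψ, (-Δ + W) ψ⟩` on its form domain. -/
def freeForm {d N : ℕ} (W : Config d N → ℝ) (ψ : Wave d N) : ℝ :=
  (∑ i, ‖weakPartial i ψ‖ ^ 2) + (∫ X, W X * ‖ψ X‖ ^ 2)

/-! ### The field: the operator `ω` and the space `𝔥_ω` -/

section Field

variable {𝔥 : Type*} [NormedAddCommGroup 𝔥] [InnerProductSpace ℂ 𝔥] [CompleteSpace 𝔥]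

/-- A nonnegative self-adjoint, possibly unbounded operator `ω` on `𝔥` which is injective, so that
it has a (possibly unbounded) inverse. -/
structure Dispersion (𝔥 : Type*) [NormedAddCommGroup 𝔥] [InnerProductSpace ℂ 𝔥]
    [CompleteSpace 𝔥] where
  op : 𝔥 →ₗ.[ℂ] 𝔥
  selfAdjoint : IsSelfAdjoint op
  nonneg : ∀ x : op.domain, 0 ≤ RCLike.re ⟪(x : 𝔥), op x⟫_ℂ
  injective : ∀ x : op.domain, op x = 0 → x = 0

/-- `σ = T^{1/2}`: `σ` is self-adjoint and nonnegative, and `σ² = T` (equality of graphs, hence also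
of domains). -/
structure IsPositiveSqrt (σ T : 𝔥 →ₗ.[ℂ] 𝔥) : Prop where
  selfAdjoint : IsSelfAdjoint σ
  nonneg : ∀ x : σ.domain, 0 ≤ RCLike.re ⟪(x : 𝔥), σ x⟫_ℂ
  sq : ∀ x y : 𝔥, (x, y) ∈ T.graph ↔ ∃ u, (x, u) ∈ σ.graph ∧ (u, y) ∈ σ.graph

open Classical in
/-- The value `T v` of a partially defined operator (`0` outside of its domain). -/
def applyOp (T : 𝔥 →ₗ.[ℂ] 𝔥) (v : 𝔥) : 𝔥 := if h : v ∈ T.domain then T ⟨v, h⟩ else 0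

namespace Dispersion

variable (ω : Dispersion 𝔥)

/-- The domain of `ω^k`. -/
def powDomain : ℕ → Submodule ℂ 𝔥
  | 0 => ⊤
  | k + 1 => ((powDomain k).comap ω.op.toFun).map ω.op.domain.subtype

/-- `⋂ₖ D(ω^k)`. -/
def smoothDomain : Submodule ℂ 𝔥 := ⨅ k, ω.powDomain k

theorem smoothDomain_le : ω.smoothDomain ≤ ω.op.domain := by
  intro x hx
  have h1 : x ∈ ω.powDomain 1 := (Submodule.mem_iInf _).1 hx 1
  obtain ⟨y, -, rfl⟩ := h1
  exact y.2

theorem symm (x y : ω.op.domain) : ⟪ω.op x, (y : 𝔥)⟫_ℂ = ⟪(x : 𝔥), ω.op y⟫_ℂ := by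
  have h := LinearPMap.adjoint_isFormalAdjoint (T := ω.op) ω.selfAdjoint.dense_domain
  rw [LinearPMap.isSelfAdjoint_def.1 ω.selfAdjoint] at h
  exact h x y

/-- `⋂ₖ D(ω^k)`, as a type which does not carry the norm of `𝔥`. -/
def SmoothVec : Type _ := ω.smoothDomain

instance : AddCommGroup ω.SmoothVec := inferInstanceAs (AddCommGroup ω.smoothDomain)

instance : Module ℂ ω.SmoothVec := inferInstanceAs (Module ℂ ω.smoothDomain)

/-- The inclusion of `⋂ₖ D(ω^k)` in `D(ω)`. -/
def toDomain : ω.SmoothVec →ₗ[ℂ] ω.op.domain := Submodule.inclusion ω.smoothDomain_le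

/-- The scalar product `⟨x, ω y⟩` on `⋂ₖ D(ω^k)`. -/
@[reducible] def core : PreInnerProductSpace.Core ℂ ω.SmoothVec where
  inner x y := ⟪(ω.toDomain x : 𝔥), ω.op (ω.toDomain y)⟫_ℂ
  conj_inner_symm x y := by
    rw [inner_conj_symm]
    exact ω.symm _ _
  re_inner_nonneg x := ω.nonneg _
  add_left x y z := by simp
  smul_left x y r := by simp [mul_comm]

instance : SeminormedAddCommGroup ω.SmoothVec :=
  InnerProductSpace.Core.toSeminormedAddCommGroup (𝕜 := ℂ) (c := ω.core)

instance : InnerProductSpace ℂ ω.SmoothVec := InnerProductSpace.ofCore ω.core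

/-- The space `𝔥_ω`: the Hilbert completion of `⋂ₖ D(ω^k)` for the scalar product `⟨x, ω y⟩`. -/
abbrev FieldSpace : Type _ := UniformSpace.Completion ω.SmoothVec

instance : MeasurableSpace ω.FieldSpace := borel _

instance : BorelSpace ω.FieldSpace := ⟨rfl⟩

/-- The isometric extension `ω^{1/2} : 𝔥_ω → 𝔥`, where `σ` is the square root of `ω`. -/
def sqrtExt (σ : 𝔥 →ₗ.[ℂ] 𝔥) : ω.FieldSpace → 𝔥 :=
  UniformSpace.Completion.extension (fun x : ω.SmoothVec => applyOp σ (ω.toDomain x : 𝔥))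

/-- The pairing `⟨z, v⟩ = ⟨ω^{1/2} z, ω^{-1/2} v⟩` of `z ∈ 𝔥_ω` and `v ∈ D(ω^{-1/2})`. -/
def pairing (σ : 𝔥 →ₗ.[ℂ] 𝔥) (z : ω.FieldSpace) (v : 𝔥) : ℂ :=
  ⟪ω.sqrtExt σ z, applyOp σ.inverse v⟫_ℂ

end Dispersion

/-- `lam` and `ω^{-1/2} lam` belong to `L^∞(ℝ^d; 𝔥)`, where `σ` is the square root of `ω`. -/
structure IsFormFactor {d : ℕ} (σ : 𝔥 →ₗ.[ℂ] 𝔥) (lam : EuclideanSpace ℝ (Fin d) → 𝔥) : Prop where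
  memLp : MemLp lam ∞ volume
  mem_domain : ∀ᵐ x, lam x ∈ σ.inverse.domain
  memLp_inv : MemLp (fun x => applyOp σ.inverse (lam x)) ∞ volume

end Field

/-! ### The energies `⟨ψ, H_z ψ⟩` of the three models -/

section Nelson

variable {𝔥 : Type*} [NormedAddCommGroup 𝔥] [InnerProductSpace ℂ 𝔥] [CompleteSpace 𝔥]

/-- The Nelson potential `V_z(x) = 2 Re ⟨z, lam(x)⟩`. -/
def nelsonPotential (ω : Dispersion 𝔥) (σ : 𝔥 →ₗ.[ℂ] 𝔥) {d : ℕ}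
    (lam : EuclideanSpace ℝ (Fin d) → 𝔥) (z : ω.FieldSpace) (x : EuclideanSpace ℝ (Fin d)) : ℝ :=
  2 * (ω.pairing σ z (lam x)).re

open Classical in
/-- The Nelson energy, the quadratic form of
`H_z = ∑ⱼ (-Δⱼ + V_z(xⱼ)) + W + ⟨z, ω z⟩`; it is `+∞` outside of the form domain. -/
def nelsonEnergy (ω : Dispersion 𝔥) (σ : 𝔥 →ₗ.[ℂ] 𝔥) {d N : ℕ} (W : Config d N → ℝ)
    (lam : EuclideanSpace ℝ (Fin d) → 𝔥) (ψ : Wave d N) (z : ω.FieldSpace) : EReal :=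
  if FormDomain W ψ then
    ((freeForm W ψ + (∑ j, (∫ X, nelsonPotential ω σ lam z (pos j X) * ‖ψ X‖ ^ 2))
      + ‖z‖ ^ 2 * ‖ψ‖ ^ 2 : ℝ) : EReal)
  else ⊤

/-- The component `l` of the classical vector potential `a_{z}(x) = 2 Re ⟨z, lam(x)⟩`. -/
def vectorPotential (ω : Dispersion 𝔥) (σ : 𝔥 →ₗ.[ℂ] 𝔥)
    (lam : Fin 3 → EuclideanSpace ℝ (Fin 3) → 𝔥) (z : ω.FieldSpace) (l : Fin 3)
    (x : EuclideanSpace ℝ (Fin 3)) : ℝ :=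
  2 * (ω.pairing σ z (lam l x)).re

open Classical in
/-- The Pauli-Fierz energy, the quadratic form of
`H_z = ∑ⱼ (2 mⱼ)⁻¹ (-i∇ⱼ + e a_{z,j}(xⱼ))² + W + ⟨z, ω z⟩`; it is `+∞` outside of the form domain.
-/
def pauliFierzEnergy (ω : Dispersion 𝔥) (σ : 𝔥 →ₗ.[ℂ] 𝔥) {N : ℕ} (W : Config 3 N → ℝ)
    (m : Fin N → ℝ) (e : ℝ) (lam : Fin N → Fin 3 → EuclideanSpace ℝ (Fin 3) → 𝔥)
    (ψ : Wave 3 N) (z : ω.FieldSpace) : EReal :=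
  if FormDomain W ψ then
    (((∑ j, 1 / (2 * m j) * (∑ l, (∫ X,
        ‖-Complex.I * weakPartial (j, l) ψ X
          + ((e * vectorPotential ω σ (lam j) z l (pos j X) : ℝ) : ℂ) * ψ X‖ ^ 2)))
      + (∫ X, W X * ‖ψ X‖ ^ 2) + ‖z‖ ^ 2 * ‖ψ‖ ^ 2 : ℝ) : EReal)
  else ⊤

end Nelson

section Polaron

/-- The field space `L²(ℝ^d)` (in momentum space) of the polaron. -/
abbrev PolaronField (d : ℕ) : Type := Lp ℂ 2 (volume : Measure (EuclideanSpace ℝ (Fin d)))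

instance (d : ℕ) : MeasurableSpace (PolaronField d) := borel _

instance (d : ℕ) : BorelSpace (PolaronField d) := ⟨rfl⟩

/-- The low momentum part `V_<(x) = 2 Re ∫_{|k| ≤ r} conj z(k) |k|^{-(d-1)/2} e^{-ik·x} dk`. -/
def polaronLow {d : ℕ} (r : ℝ) (z : PolaronField d) (x : EuclideanSpace ℝ (Fin d)) : ℝ :=
  2 * (∫ k in {k : EuclideanSpace ℝ (Fin d) | ‖k‖ ≤ r},
    (starRingEnd ℂ) (z k) * ((‖k‖ ^ (-(((d : ℝ) - 1) / 2)) : ℝ) : ℂ)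
      * Complex.exp (-Complex.I * ((⟪k, x⟫_ℝ : ℝ) : ℂ))).re

/-- The component `l` of the bounded vector field
`G(x) = 2 Re ∫_{|k| > r} conj z(k) (i k / |k|) |k|^{-(d+1)/2} e^{-ik·x} dk`, whose divergence is
formally `2 Re ∫_{|k| > r} conj z(k) |k|^{-(d-1)/2} e^{-ik·x} dk`. -/
def polaronHigh {d : ℕ} (r : ℝ) (z : PolaronField d) (l : Fin d)
    (x : EuclideanSpace ℝ (Fin d)) : ℝ :=
  2 * (∫ k in {k : EuclideanSpace ℝ (Fin d) | r < ‖k‖},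
    (starRingEnd ℂ) (z k) * (Complex.I * ((k l / ‖k‖ : ℝ) : ℂ))
      * ((‖k‖ ^ (-(((d : ℝ) + 1) / 2)) : ℝ) : ℂ)
      * Complex.exp (-Complex.I * ((⟪k, x⟫_ℝ : ℝ) : ℂ))).re

open Classical in
/-- The polaron energy, the quadratic form of `H_z = ∑ⱼ (-Δⱼ + V_z(xⱼ)) + W + ‖z‖²` with
`V_z(x) = 2 √α Re ∫ conj z(k) |k|^{-(d-1)/2} e^{-ik·x} dk`, which is read as
`√α (V_< + [∇·, G])`, so that `⟨ψ, [∇ⱼ·, G(xⱼ)] ψ⟩ = -2 Re ∫ conj ψ G(xⱼ)·∇ⱼψ`. It is `+∞` outside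
of the form domain. -/
def polaronEnergy {d N : ℕ} (W : Config d N → ℝ) (α r : ℝ) (ψ : Wave d N)
    (z : PolaronField d) : EReal :=
  if FormDomain W ψ then
    ((freeForm W ψ
      + Real.sqrt α * (∑ j, ((∫ X, polaronLow r z (pos j X) * ‖ψ X‖ ^ 2)
          - 2 * (∑ l, (∫ X, (starRingEnd ℂ) (ψ X) * (polaronHigh r z l (pos j X) : ℂ)
              * weakPartial (j, l) ψ X).re)))
      + ‖z‖ ^ 2 * ‖ψ‖ ^ 2 : ℝ) : EReal)
  else ⊤

end Polaron

/-! ### State-valued measures -/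

section StateValued

variable {H : Type*} [NormedAddCommGroup H] [InnerProductSpace ℂ H] [CompleteSpace H]
variable {K : Type*} [MeasurableSpace K]

/-- The trace norm `‖T‖₁`, the supremum of `∑ᵢ |⟨fᵢ, T eᵢ⟩|` over finite orthonormal families; `T` is
trace class iff it is finite, and it is the trace of `T` if `T ≥ 0`. -/
def traceNorm (T : H →L[ℂ] H) : ℝ≥0∞ :=
  ⨆ (n : ℕ) (e : Fin n → H) (f : Fin n → H) (_ : Orthonormal ℂ e) (_ : Orthonormal ℂ f),
    ∑ i, ‖⟪f i, T (e i)⟫_ℂ‖ₑ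

/-- Normalized density matrices: nonnegative operators of trace one. -/
def IsDensityMatrix (γ : H →L[ℂ] H) : Prop := γ.IsPositive ∧ traceNorm γ = 1

/-- State-valued probability measures: measures on `K` with values in the nonnegative trace class
operators, `σ`-additive (unconditionally) in trace norm, of total trace one. -/
structure StateValuedMeasure (K H : Type*) [MeasurableSpace K] [NormedAddCommGroup H]
    [InnerProductSpace ℂ H] [CompleteSpace H] where
  toFun : Set K → H →L[ℂ] H
  positive : ∀ S, MeasurableSet S → (toFun S).IsPositive
  traceClass : ∀ S, MeasurableSet S → traceNorm (toFun S) < ∞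
  empty : toFun ∅ = 0
  additive : ∀ S : ℕ → Set K, (∀ n, MeasurableSet (S n)) → Pairwise (Function.onFun Disjoint S) →
    Tendsto (fun F : Finset ℕ => traceNorm (toFun (⋃ n, S n) - ∑ n ∈ F, toFun (S n)))
      atTop (𝓝 0)
  normalized : traceNorm (toFun univ) = 1

/-- The Radon-Nikodym decomposition `d𝔪(z) = γ(z) dμ(z)`, with `μ` a probability measure and `γ(z)`
normalized density matrices. -/
structure IsRadonNikodym (m : StateValuedMeasure K H) (μ : Measure K) (γ : K → H →L[ℂ] H) :
    Prop where
  prob : IsProbabilityMeasure μ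
  density : ∀ᵐ z ∂μ, IsDensityMatrix (γ z)
  measurable : ∀ φ χ : H, AEStronglyMeasurable (fun z => ⟪φ, γ z χ⟫_ℂ) μ
  eq_integral : ∀ S, MeasurableSet S → ∀ φ χ : H,
    ⟪φ, m.toFun S χ⟫_ℂ = ∫ z in S, ⟪φ, γ z χ⟫_ℂ ∂μ

/-- `γ = ∑ₖ wₖ |ψₖ⟩⟨ψₖ|` with `wₖ ≥ 0` and the `ψₖ` with `wₖ ≠ 0` orthonormal. -/
structure IsSpectralDecomposition (γ : H →L[ℂ] H) (w : ℕ → ℝ) (ψ : ℕ → H) : Prop where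
  nonneg : ∀ k, 0 ≤ w k
  orthonormal : Orthonormal ℂ (fun k : {k : ℕ // w k ≠ 0} => ψ k)
  hasSum : ∀ φ : H, HasSum (fun k => ((w k : ℂ) * ⟪ψ k, φ⟫_ℂ) • ψ k) (γ φ)

/-- A value in `ℝ ∪ {±∞}` is finite. -/
def IsFin (a : EReal) : Prop := a ≠ ⊥ ∧ a ≠ ⊤

open Classical in
/-- The integral of an extended real function, with value `+∞` if the function is not integrable.
The functions to which this is applied are bounded from below. -/
def extIntegral (μ : Measure K) (f : K → EReal) : EReal :=
  if (∀ᵐ z ∂μ, IsFin (f z)) ∧ Integrable (fun z => (f z).toReal) μ then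
    ((∫ z, (f z).toReal ∂μ : ℝ) : EReal)
  else ⊤

open Classical in
/-- The sum `∑ₖ wₖ f(k)`, with value `+∞` if it is not a convergent sum of finite terms. -/
def extSum (w : ℕ → ℝ) (f : ℕ → EReal) : EReal :=
  if (∀ k, w k ≠ 0 → IsFin (f k)) ∧ Summable (fun k => w k * (f k).toReal) then
    ((∑' k, w k * (f k).toReal : ℝ) : EReal)
  else ⊤

open Classical in
/-- `tr[γ A]` for a density matrix `γ` and a quadratic form `q(ψ) = ⟨ψ, A ψ⟩` bounded from below:
`∑ₖ wₖ q(ψₖ)` if `γ = ∑ₖ wₖ |ψₖ⟩⟨ψₖ|` is a spectral decomposition. The value does not depend on the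
one which is chosen. -/
def traceForm (q : H → EReal) (γ : H →L[ℂ] H) : EReal :=
  if h : ∃ p : (ℕ → ℝ) × (ℕ → H), IsSpectralDecomposition γ p.1 p.2 then
    extSum h.choose.1 (fun k => q (h.choose.2 k))
  else ⊤

/-! ### The variational problems, for an energy `E ψ z = ⟨ψ, H_z ψ⟩` -/

/-- `a` belongs to the domain `D` and minimizes `F` there. -/
def IsMinimizer {α : Type*} (D : Set α) (F : α → EReal) (a : α) : Prop :=
  a ∈ D ∧ F a = ⨅ b ∈ D, F b

/-- `(ψ, z)` minimizes the quasi-classical energy. -/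
def IsQcMinimizer (E : H → K → EReal) (p : H × K) : Prop :=
  IsMinimizer {p : H × K | ‖p.1‖ = 1 ∧ IsFin (E p.1 p.2)} (fun p => E p.1 p.2) p

/-- `ψ` minimizes the Pekar functional `P`. -/
def IsPekarMinimizer (P : H → EReal) (ψ : H) : Prop :=
  IsMinimizer {ψ : H | ‖ψ‖ = 1 ∧ IsFin (P ψ)} P ψ

open Classical in
/-- The energy `∫ dμ(z) tr[γ(z) H_z]` of the state-valued measure `d𝔪(z) = γ(z) dμ(z)`. The
Radon-Nikodym decomposition is unique up to null sets. -/
def svmEnergy (E : H → K → EReal) (m : StateValuedMeasure K H) : EReal :=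
  if h : ∃ p : Measure K × (K → H →L[ℂ] H), IsRadonNikodym m p.1 p.2 then
    extIntegral h.choose.1 (fun z => traceForm (fun ψ => E ψ z) (h.choose.2 z))
  else ⊤

/-- `𝔪` minimizes the energy of state-valued measures. -/
def IsSvmMinimizer (E : H → K → EReal) (m : StateValuedMeasure K H) : Prop :=
  IsMinimizer {m | IsFin (svmEnergy E m)} (svmEnergy E) m

/-- The energy `∫ dμ(z) ⟨ψ, H_z ψ⟩` of a product of a wave function and a measure. -/
def pmEnergy (E : H → K → EReal) (p : H × Measure K) : EReal := extIntegral p.2 (E p.1)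

/-- `(ψ, μ)` minimizes the energy of product measures. -/
def IsPmMinimizer (E : H → K → EReal) (p : H × Measure K) : Prop :=
  IsMinimizer {p : H × Measure K | ‖p.1‖ = 1 ∧ IsProbabilityMeasure p.2 ∧ IsFin (pmEnergy E p)}
    (pmEnergy E) p

/-- `d𝔪(z) = γ(z) dμ(z)` is concentrated on the minimizers of the quasi-classical energy: for
`μ`-almost every `z`, all the normalized eigenvectors `ψ` of `γ(z)` with nonzero eigenvalue, i.e. all
the pure states of which `γ(z)` is a mixture, are such that `(ψ, z)` is a minimizer. -/
def IsConcentratedOnMinimizers (E : H → K → EReal) (m : StateValuedMeasure K H) : Prop :=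
  (∃ (μ : Measure K) (γ : K → H →L[ℂ] H), IsRadonNikodym m μ γ) ∧
  ∀ (μ : Measure K) (γ : K → H →L[ℂ] H), IsRadonNikodym m μ γ →
    ∀ᵐ z ∂μ, ∀ (ψ : H) (c : ℂ), ‖ψ‖ = 1 → c ≠ 0 → γ z ψ = c • ψ → IsQcMinimizer E (ψ, z)

/-- The Pekar functional obtained by minimizing over the field. -/
def pekarInf (E : H → K → EReal) (ψ : H) : EReal := ⨅ z, E ψ z

/-- `z` is a critical point of the energy of `ψ` as a function of the field. -/
def IsCriticalField {K : Type*} [AddCommGroup K] [Module ℂ K] (E : H → K → EReal) (ψ : H) (z : K) :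
    Prop :=
  IsFin (E ψ z) ∧ ∀ v : K, HasDerivAt (fun t : ℝ => (E ψ (z + (t : ℂ) • v)).toReal) 0 0

open Classical in
/-- The Pekar functional `E[ψ, z_ψ]`, where `z_ψ` is the critical point of `z ↦ E[ψ, z]`. -/
def pekarCritical {K : Type*} [AddCommGroup K] [Module ℂ K] (E : H → K → EReal) (ψ : H) : EReal :=
  if h : ∃ z, IsCriticalField E ψ z then E ψ h.choose else ⊤

end StateValued

end QuasiClassical

end

open MeasureTheory Set Filter Topology
open scoped ENNReal InnerProductSpace

noncomputable section

namespace QuasiClassical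

/-! ### The trace of a nonnegative operator -/

section Trace

variable {H : Type*} [NormedAddCommGroup H] [InnerProductSpace ℂ H]

/-! The energies of state-valued measures and of product measures are averages of values of the
quasi-classical energy: over `z`, and in the first case also over the eigenvectors of `γ(z)`,
weighted by eigenvalues that sum to one. An average is at least any lower bound of its values.
Conversely `|ψ⟩⟨ψ| δ_z` and `(ψ, δ_z)` have exactly the energy of `(ψ, z)`, so the problems have the
same infimum. A probability average equals a lower bound only if almost every value does, so
minimizers of the averaged problems yield minimizing pairs `(ψ, z)`. Semiboundedness of the energy
is not assumed: a minimizer has finite energy, and this value is the lower bound. The abstract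
statement is `tfae_exists_minimizer`.

For the Pekar functionals, fix a normalized `ψ` in the form domain. In each model the energy is a
convex quadratic polynomial of the field plus `‖z‖²`. By Lax-Milgram it has a critical point, and
every critical point is a global minimizer (`IsConvexQuadratic.critical_add_norm_sq`). Hence both
kinds of Pekar functional are attained minima over `z`.

Concentration asks for all eigenvectors, not only those of one spectral decomposition. An
eigenvector for a nonzero eigenvalue is a finite combination of vectors of the decomposition
(`IsSpectralDecomposition.mem_span_of_eigenvector`), and the vectors at which a quadratic form
attains its lower bound form a linear space (`IsQuadraticOn.eq_of_mem_span`).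

The energies are defined with chosen decompositions. Uniqueness of the Radon-Nikodym decomposition,
which follows from separability, makes these choices harmless. What is left for the models is that
the energy is quadratic in `ψ` and convex quadratic in `z`; both follow from writing the interaction
through multiplication by bounded functions that are real linear in `z` (`IsCoupling`). -/

theorem countable_of_orthonormal [TopologicalSpace.SeparableSpace H] {ι : Type*} {v : ι → H}
    (hv : Orthonormal ℂ v) : Countable ι := by
  -- Distinct orthonormal vectors are at distance `√2`, so balls of radius `1/2` around them are
  -- disjoint.
  have hdist : ∀ i j, i ≠ j → 1 ≤ dist (v i) (v j) := by
    intro i j hij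
    have h : ‖v i - v j‖ ^ 2 = 2 := by
      rw [@norm_sub_sq ℂ, hv.1 i, hv.1 j, hv.2 hij]
      norm_num
    rw [dist_eq_norm]
    nlinarith [norm_nonneg (v i - v j)]
  refine Pairwise.countable_of_isOpen_disjoint (s := fun i => Metric.ball (v i) (1 / 2)) ?_
    (fun i => Metric.isOpen_ball) (fun i => ⟨v i, Metric.mem_ball_self (by norm_num)⟩)
  intro i j hij
  exact Metric.ball_disjoint_ball (by linarith [hdist i j hij])

/-- Parseval's identity in `ℝ≥0∞`, where sums can be exchanged without summability conditions. -/
theorem hilbertBasis_tsum_enorm_sq {ι : Type*} (b : HilbertBasis ι ℂ H) (x : H) :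
    ∑' i, ENNReal.ofReal (‖⟪b i, x⟫_ℂ‖ ^ 2) = ENNReal.ofReal (‖x‖ ^ 2) := by
  have h := b.hasSum_inner_mul_inner x x
  have h2 : HasSum (fun i => ‖⟪b i, x⟫_ℂ‖ ^ 2) (‖x‖ ^ 2) := by
    have h3 := Complex.hasSum_re h
    convert h3 using 1
    · ext i
      rw [← RCLike.re_eq_complex_re, inner_mul_symm_re_eq_norm, norm_mul, norm_inner_symm x, sq]
    · exact norm_sq_eq_re_inner (𝕜 := ℂ) x
  rw [← h2.tsum_eq, ENNReal.ofReal_tsum_of_nonneg (fun i => by positivity) h2.summable]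

/-- One-element families in the supremum that defines `traceNorm` control the operator norm. This
makes matrix elements of densities integrable. -/
theorem norm_inner_le_of_traceNorm_le_one {γ : H →L[ℂ] H} (hγ : traceNorm γ ≤ 1) (φ χ : H) :
    ‖⟪φ, γ χ⟫_ℂ‖ ≤ ‖φ‖ * ‖χ‖ := by
  by_cases hφ : φ = 0
  · simp [hφ]
  by_cases hχ : χ = 0
  · simp [hχ]
  have ho : ∀ x : H, x ≠ 0 → Orthonormal ℂ (fun _ : Fin 1 => ((‖x‖⁻¹ : ℝ) : ℂ) • x) := by
    intro x hx
    refine ⟨fun _ => ?_, fun i j hij => absurd (Subsingleton.elim i j) hij⟩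
    rw [norm_smul, Complex.norm_real, norm_inv, norm_norm, inv_mul_cancel₀ (norm_ne_zero_iff.2 hx)]
  have h : ∑ _ : Fin 1, ‖⟪((‖φ‖⁻¹ : ℝ) : ℂ) • φ, γ (((‖χ‖⁻¹ : ℝ) : ℂ) • χ)⟫_ℂ‖ₑ ≤ 1 := by
    refine le_trans ?_ hγ
    unfold traceNorm
    exact le_iSup_of_le 1 (le_iSup_of_le (fun _ => ((‖χ‖⁻¹ : ℝ) : ℂ) • χ)
      (le_iSup_of_le (fun _ => ((‖φ‖⁻¹ : ℝ) : ℂ) • φ) (le_iSup_of_le (ho χ hχ)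
      (le_iSup_of_le (ho φ hφ) le_rfl))))
  rw [Fin.sum_univ_one, map_smul, inner_smul_left, inner_smul_right, ← ofReal_norm,
    ← ENNReal.ofReal_one, ENNReal.ofReal_le_ofReal_iff zero_le_one, Complex.conj_ofReal, norm_mul,
    norm_mul, Complex.norm_real, Complex.norm_real, norm_inv, norm_inv, norm_norm, norm_norm] at h
  have h1 : 0 < ‖φ‖ := norm_pos_iff.2 hφ
  have h2 : 0 < ‖χ‖ := norm_pos_iff.2 hχ
  field_simp at h
  linarith

theorem traceNorm_zero : traceNorm (0 : H →L[ℂ] H) = 0 := by simp [traceNorm]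

theorem IsSpectralDecomposition.inner_apply {γ : H →L[ℂ] H} {w : ℕ → ℝ} {ψ : ℕ → H}
    (h : IsSpectralDecomposition γ w ψ) {k : ℕ} (hk : w k ≠ 0) (φ : H) :
    ⟪ψ k, γ φ⟫_ℂ = w k * ⟪ψ k, φ⟫_ℂ := by
  have hs : HasSum (fun j => ⟪ψ k, ((w j : ℂ) * ⟪ψ j, φ⟫_ℂ) • ψ j⟫_ℂ) ⟪ψ k, γ φ⟫_ℂ :=
    (h.hasSum φ).mapL (innerSL ℂ (ψ k))
  refine hs.unique ?_
  convert hasSum_single k ?_ using 1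
  · have h1 : ⟪ψ k, ψ k⟫_ℂ = 1 := by
      rw [inner_self_eq_norm_sq_to_K, h.orthonormal.1 ⟨k, hk⟩]; simp
    rw [inner_smul_right, h1, mul_one]
  · intro j hj
    by_cases hw : w j = 0
    · simp [hw]
    · have : ⟪ψ k, ψ j⟫_ℂ = 0 :=
        h.orthonormal.2 (i := ⟨k, hk⟩) (j := ⟨j, hw⟩) (by simpa using hj.symm)
      rw [inner_smul_right, this, mul_zero]

theorem IsSpectralDecomposition.apply_eigenvector {γ : H →L[ℂ] H} {w : ℕ → ℝ} {ψ : ℕ → H}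
    (h : IsSpectralDecomposition γ w ψ) {k : ℕ} (hk : w k ≠ 0) :
    γ (ψ k) = (w k : ℂ) • ψ k := by
  refine (h.hasSum (ψ k)).unique ?_
  convert hasSum_single k ?_ using 1
  · have h1 : ⟪ψ k, ψ k⟫_ℂ = 1 := by
      rw [inner_self_eq_norm_sq_to_K, h.orthonormal.1 ⟨k, hk⟩]; simp
    rw [h1, mul_one]
  · intro j hj
    by_cases hw : w j = 0
    · simp [hw]
    · have : ⟪ψ j, ψ k⟫_ℂ = 0 :=
        h.orthonormal.2 (i := ⟨j, hw⟩) (j := ⟨k, hk⟩) (by simpa using hj)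
      rw [this, mul_zero, zero_smul]

/-- The constant sequence `ψ` is admissible because orthonormality is required only where the weight
is nonzero, here at the index `0`. -/
theorem isSpectralDecomposition_rankOne {ψ : H} (hψ : ‖ψ‖ = 1) :
    IsSpectralDecomposition (InnerProductSpace.rankOne ℂ ψ ψ) (Pi.single 0 1) (fun _ => ψ) where
  nonneg k := by by_cases hk : k = 0 <;> simp [hk]
  orthonormal := by
    refine ⟨fun _ => hψ, fun i j hij => ?_⟩
    have hz : ∀ i : {k : ℕ // (Pi.single 0 1 : ℕ → ℝ) k ≠ 0}, (i : ℕ) = 0 := by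
      intro i
      by_contra hi
      exact i.2 (by simp [hi])
    exact absurd (Subtype.ext ((hz i).trans (hz j).symm)) hij
  hasSum φ := by
    convert hasSum_single 0 ?_ using 1
    · simp
    · intro k hk
      simp [hk]

/-- An eigenvector for a nonzero eigenvalue is a combination of the vectors of any spectral
decomposition. -/
theorem IsSpectralDecomposition.mem_span_of_eigenvector {γ : H →L[ℂ] H} {w : ℕ → ℝ} {ψ : ℕ → H}
    (h : IsSpectralDecomposition γ w ψ) (hw : Summable w) {φ : H} {c : ℂ} (hc : c ≠ 0)
    (hφ : γ φ = c • φ) : φ ∈ Submodule.span ℂ (ψ '' {k | w k ≠ 0}) := by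
  -- Summable weights tend to zero, so only finitely many equal `c ≠ 0`. Hence `γ φ` is a finite sum
  -- and lies in the algebraic span, not merely in its closure, which could leave the form domain.
  have hfin : {k | (w k : ℂ) = c}.Finite := by
    have ht := hw.tendsto_cofinite_zero
    have hev : ∀ᶠ k in cofinite, |w k| < ‖c‖ := by
      have := ht.abs
      rw [abs_zero] at this
      exact this.eventually_lt_const (norm_pos_iff.2 hc)
    refine (Filter.eventually_cofinite.1 hev).subset fun k hk => ?_
    simp only [mem_ofPred_eq] at hk ⊢
    rw [← hk, Complex.norm_real, Real.norm_eq_abs]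
    exact lt_irrefl _
  have hzero : ∀ k, k ∉ hfin.toFinset → ((w k : ℂ) * ⟪ψ k, φ⟫_ℂ) • ψ k = 0 := by
    intro k hk
    by_cases hwk : w k = 0
    · simp [hwk]
    have h1 := h.inner_apply hwk φ
    rw [hφ, inner_smul_right] at h1
    have hne : (w k : ℂ) ≠ c := by simpa using hk
    have h2 : ⟪ψ k, φ⟫_ℂ = 0 := by
      have : (c - w k) * ⟪ψ k, φ⟫_ℂ = 0 := by rw [sub_mul, h1, sub_self]
      exact (mul_eq_zero.1 this).resolve_left (sub_ne_zero.2 hne.symm)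
    simp [h2]
  have hsum := (h.hasSum φ).unique (hasSum_sum_of_ne_finset_zero (s := hfin.toFinset) hzero)
  have hmem : γ φ ∈ Submodule.span ℂ (ψ '' {k | w k ≠ 0}) := by
    rw [hsum]
    refine Submodule.sum_mem _ fun k hk => Submodule.smul_mem _ _ (Submodule.subset_span ⟨k, ?_, rfl⟩)
    have hk' : (w k : ℂ) = c := by simpa using hk
    rintro h0
    rw [h0, Complex.ofReal_zero] at hk'
    exact hc hk'.symm
  rw [hφ] at hmem
  exact (Submodule.smul_mem_iff _ hc).1 hmem

variable [CompleteSpace H]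

/-- Parseval in `b`, an exchange of sums, self-adjointness, and Bessel's inequality for each `A (b
i)`. -/
theorem sum_norm_sq_le_of_orthonormal {ι : Type*} (b : HilbertBasis ι ℂ H) {A : H →L[ℂ] H}
    (hA : IsSelfAdjoint A) {n : ℕ} {e : Fin n → H} (he : Orthonormal ℂ e) :
    ∑ j, ENNReal.ofReal (‖A (e j)‖ ^ 2) ≤ ∑' i, ENNReal.ofReal (‖A (b i)‖ ^ 2) := by
  calc ∑ j, ENNReal.ofReal (‖A (e j)‖ ^ 2)
      = ∑ j, ∑' i, ENNReal.ofReal (‖⟪b i, A (e j)⟫_ℂ‖ ^ 2) := by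
        simp_rw [hilbertBasis_tsum_enorm_sq b]
    _ = ∑' i, ∑ j, ENNReal.ofReal (‖⟪b i, A (e j)⟫_ℂ‖ ^ 2) :=
        (Summable.tsum_finsetSum fun _ _ => ENNReal.summable).symm
    _ ≤ ∑' i, ENNReal.ofReal (‖A (b i)‖ ^ 2) := by
        refine ENNReal.tsum_le_tsum fun i => ?_
        rw [← ENNReal.ofReal_sum_of_nonneg fun j _ => by positivity]
        refine ENNReal.ofReal_le_ofReal ?_
        have h := he.sum_inner_products_le (A (b i)) (s := Finset.univ)
        refine le_trans (le_of_eq (Finset.sum_congr rfl fun j _ => ?_)) h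
        have hs : ⟪b i, A (e j)⟫_ℂ = ⟪A (b i), e j⟫_ℂ := (hA.isSymmetric _ _).symm
        rw [hs, norm_inner_symm]

theorem exists_selfAdjoint_sqrt {γ : H →L[ℂ] H} (hγ : γ.IsPositive) :
    ∃ A : H →L[ℂ] H, IsSelfAdjoint A ∧ ∀ x y, ⟪x, γ y⟫_ℂ = ⟪A x, A y⟫_ℂ := by
  have h0 : 0 ≤ γ := (ContinuousLinearMap.nonneg_iff_isPositive γ).2 hγ
  have hsa : IsSelfAdjoint (CFC.sqrt γ) := IsSelfAdjoint.of_nonneg (CFC.sqrt_nonneg γ)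
  refine ⟨CFC.sqrt γ, hsa, fun x y => ?_⟩
  have h := CFC.sqrt_mul_sqrt_self γ h0
  conv_lhs => rw [← h]
  exact (hsa.isSymmetric _ _).symm

/-- The trace norm of a nonnegative operator is the sum of its diagonal entries in any basis. -/
theorem traceNorm_eq_tsum_diagonal {ι : Type*} (b : HilbertBasis ι ℂ H) {γ : H →L[ℂ] H}
    (hγ : γ.IsPositive) :
    traceNorm γ = ∑' i, ENNReal.ofReal (⟪b i, γ (b i)⟫_ℂ).re := by
  obtain ⟨A, hA, hAγ⟩ := exists_selfAdjoint_sqrt hγ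
  have hdiag : ∀ x, (⟪x, γ x⟫_ℂ).re = ‖A x‖ ^ 2 := by
    intro x
    rw [hAγ]
    exact (norm_sq_eq_re_inner (𝕜 := ℂ) (A x)).symm
  simp_rw [hdiag]
  refine le_antisymm ?_ ?_
  · unfold traceNorm
    refine iSup_le fun n => iSup_le fun e => iSup_le fun f => iSup_le fun he => iSup_le fun hf => ?_
    -- With `γ = A²`, Cauchy-Schwarz and `2ab ≤ a² + b²` reduce the mixed entries to Hilbert-Schmidt
    -- sums of `A` over each family.
    have hterm : ∀ i, ‖⟪f i, γ (e i)⟫_ℂ‖ₑ ≤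
        2⁻¹ * ENNReal.ofReal (‖A (f i)‖ ^ 2) + 2⁻¹ * ENNReal.ofReal (‖A (e i)‖ ^ 2) := by
      intro i
      have h2 : (2⁻¹ : ℝ≥0∞) = ENNReal.ofReal (2⁻¹) := by
        rw [ENNReal.ofReal_inv_of_pos (by norm_num)]; norm_num
      rw [h2, ← ENNReal.ofReal_mul (by norm_num), ← ENNReal.ofReal_mul (by norm_num),
        ← ENNReal.ofReal_add (by positivity) (by positivity), ← ofReal_norm]
      refine ENNReal.ofReal_le_ofReal ?_
      rw [hAγ]
      have := norm_inner_le_norm (𝕜 := ℂ) (A (f i)) (A (e i))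
      nlinarith [sq_nonneg (‖A (f i)‖ - ‖A (e i)‖)]
    calc ∑ i, ‖⟪f i, γ (e i)⟫_ℂ‖ₑ
        ≤ ∑ i, (2⁻¹ * ENNReal.ofReal (‖A (f i)‖ ^ 2) + 2⁻¹ * ENNReal.ofReal (‖A (e i)‖ ^ 2)) :=
          Finset.sum_le_sum fun i _ => hterm i
      _ = 2⁻¹ * ∑ i, ENNReal.ofReal (‖A (f i)‖ ^ 2)
            + 2⁻¹ * ∑ i, ENNReal.ofReal (‖A (e i)‖ ^ 2) := by
          rw [Finset.sum_add_distrib, Finset.mul_sum, Finset.mul_sum]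
      _ ≤ 2⁻¹ * (∑' i, ENNReal.ofReal (‖A (b i)‖ ^ 2))
            + 2⁻¹ * ∑' i, ENNReal.ofReal (‖A (b i)‖ ^ 2) := by
          gcongr
          · exact sum_norm_sq_le_of_orthonormal b hA hf
          · exact sum_norm_sq_le_of_orthonormal b hA he
      _ = ∑' i, ENNReal.ofReal (‖A (b i)‖ ^ 2) := by
          rw [← add_mul, ENNReal.inv_two_add_inv_two, one_mul]
  · rw [ENNReal.tsum_eq_iSup_sum]
    refine iSup_le fun s => ?_
    let g : Fin s.card → ι := fun i => s.equivFin.symm i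
    have hg : Function.Injective g := fun i j hij => s.equivFin.symm.injective (Subtype.ext hij)
    have ho : Orthonormal ℂ (fun i => b (g i)) := b.orthonormal.comp g hg
    have hle : ∑ i, ‖⟪b (g i), γ (b (g i))⟫_ℂ‖ₑ ≤ traceNorm γ := by
      unfold traceNorm
      exact le_iSup_of_le _ (le_iSup_of_le _ (le_iSup_of_le _ (le_iSup_of_le ho
        (le_iSup_of_le ho le_rfl))))
    refine le_trans ?_ hle
    rw [← Finset.sum_coe_sort, ← Equiv.sum_comp s.equivFin.symm]
    refine Finset.sum_le_sum fun i _ => ?_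
    rw [← ofReal_norm, ← hdiag]
    exact ENNReal.ofReal_le_ofReal (Complex.re_le_norm _)

/-- The eigenvalues of a density matrix sum to one. -/
theorem IsSpectralDecomposition.hasSum_weights {γ : H →L[ℂ] H} {w : ℕ → ℝ} {ψ : ℕ → H}
    (h : IsSpectralDecomposition γ w ψ) (hγ : IsDensityMatrix γ) : HasSum w 1 := by
  obtain ⟨s, b, -⟩ := exists_hilbertBasis ℂ H
  have hdiag : ∀ i, ENNReal.ofReal (⟪b i, γ (b i)⟫_ℂ).re
      = ∑' k, ENNReal.ofReal (w k) * ENNReal.ofReal (‖⟪b i, ψ k⟫_ℂ‖ ^ 2) := by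
    intro i
    have hs : HasSum (fun j => ⟪b i, ((w j : ℂ) * ⟪ψ j, b i⟫_ℂ) • ψ j⟫_ℂ) ⟪b i, γ (b i)⟫_ℂ :=
      (h.hasSum (b i)).mapL (innerSL ℂ (b i))
    have hs' : HasSum (fun j => w j * ‖⟪b i, ψ j⟫_ℂ‖ ^ 2) (⟪b i, γ (b i)⟫_ℂ).re := by
      convert Complex.hasSum_re hs using 1
      ext j
      rw [inner_smul_right, mul_assoc, Complex.re_ofReal_mul, ← RCLike.re_eq_complex_re,
        inner_mul_symm_re_eq_norm, norm_mul, norm_inner_symm (ψ j), ← sq]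
    rw [← hs'.tsum_eq, ENNReal.ofReal_tsum_of_nonneg
      (fun k => mul_nonneg (h.nonneg k) (by positivity)) hs'.summable]
    exact tsum_congr fun k => ENNReal.ofReal_mul (h.nonneg k)
  -- The trace in the basis `b` and the sum over eigenvalues are exchanged; Parseval for each `ψ k`
  -- leaves its weight. Vectors of weight zero may have any norm.
  have htr : ∑' k, ENNReal.ofReal (w k) = 1 := by
    rw [← hγ.2, traceNorm_eq_tsum_diagonal b hγ.1]
    simp_rw [hdiag]
    rw [ENNReal.tsum_comm]
    refine tsum_congr fun k => ?_
    rw [ENNReal.tsum_mul_left, hilbertBasis_tsum_enorm_sq b]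
    by_cases hw : w k = 0
    · simp [hw]
    · rw [h.orthonormal.1 ⟨k, hw⟩]; simp
  have hsum : Summable w := by
    have := ENNReal.summable_toReal (f := fun k => ENNReal.ofReal (w k)) (by rw [htr]; simp)
    simpa [ENNReal.toReal_ofReal (h.nonneg _)] using this
  have h1 : ∑' k, w k = 1 := by
    rw [← ENNReal.ofReal_tsum_of_nonneg h.nonneg hsum] at htr
    exact (ENNReal.ofReal_eq_one).1 htr
  exact h1 ▸ hsum.hasSum

theorem isDensityMatrix_rankOne {ψ : H} (hψ : ‖ψ‖ = 1) :
    IsDensityMatrix (InnerProductSpace.rankOne ℂ ψ ψ) := by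
  refine ⟨InnerProductSpace.isPositive_rankOne_self ψ, ?_⟩
  obtain ⟨s, b, -⟩ := exists_hilbertBasis ℂ H
  rw [traceNorm_eq_tsum_diagonal b (InnerProductSpace.isPositive_rankOne_self ψ)]
  have : ∀ i, (⟪b i, InnerProductSpace.rankOne ℂ ψ ψ (b i)⟫_ℂ).re = ‖⟪b i, ψ⟫_ℂ‖ ^ 2 := by
    intro i
    rw [InnerProductSpace.rankOne_apply, inner_smul_right, ← RCLike.re_eq_complex_re,
      inner_mul_symm_re_eq_norm, norm_mul, norm_inner_symm ψ, sq]
  simp_rw [this, hilbertBasis_tsum_enorm_sq b, hψ]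
  simp

end Trace

/-! ### Uniqueness of the Radon-Nikodym decomposition -/

section RadonNikodym

variable {H : Type*} [NormedAddCommGroup H] [InnerProductSpace ℂ H] [CompleteSpace H]
variable {K : Type*} [MeasurableSpace K]
variable {m : StateValuedMeasure K H} {μ μ' : Measure K} {γ γ' : K → H →L[ℂ] H}

theorem IsRadonNikodym.integrable_inner (h : IsRadonNikodym m μ γ) (φ χ : H) :
    Integrable (fun z => ⟪φ, γ z χ⟫_ℂ) μ := by
  have := h.prob
  exact Integrable.of_bound (h.measurable φ χ) (‖φ‖ * ‖χ‖)
    (h.density.mono fun z hz => norm_inner_le_of_traceNorm_le_one hz.2.le φ χ)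

/-- The scalar measure is the trace of the state-valued measure. -/
theorem IsRadonNikodym.measure_apply {ι : Type*} [Countable ι] (b : HilbertBasis ι ℂ H)
    (h : IsRadonNikodym m μ γ) {S : Set K} (hS : MeasurableSet S) :
    μ S = ∑' i, ENNReal.ofReal (⟪b i, m.toFun S (b i)⟫_ℂ).re := by
  have hint : ∀ i, Integrable (fun z => (⟪b i, γ z (b i)⟫_ℂ).re) (μ.restrict S) := fun i =>
    (h.integrable_inner (b i) (b i)).re.restrict
  -- The integrand `1` is the trace of `γ z`, expanded in the countable basis and integrated
  -- termwise.
  calc μ S = ∫⁻ _ in S, 1 ∂μ := by simp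
    _ = ∫⁻ z in S, ∑' i, ENNReal.ofReal (⟪b i, γ z (b i)⟫_ℂ).re ∂μ := by
        refine lintegral_congr_ae (ae_restrict_of_ae (h.density.mono fun z hz => ?_))
        simp only
        rw [← traceNorm_eq_tsum_diagonal b hz.1, hz.2]
    _ = ∑' i, ∫⁻ z in S, ENNReal.ofReal (⟪b i, γ z (b i)⟫_ℂ).re ∂μ :=
        lintegral_tsum fun i => (hint i).aestronglyMeasurable.aemeasurable.ennreal_ofReal
    _ = ∑' i, ENNReal.ofReal (⟪b i, m.toFun S (b i)⟫_ℂ).re := by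
        refine tsum_congr fun i => ?_
        rw [← ofReal_integral_eq_lintegral_ofReal (hint i)
          (ae_restrict_of_ae (h.density.mono fun z hz => hz.1.re_inner_nonneg_right (b i))),
          h.eq_integral S hS]
        congr 1
        exact integral_re (h.integrable_inner (b i) (b i)).restrict

/-- The right side of `measure_apply` involves only `m`. -/
theorem IsRadonNikodym.measure_eq [TopologicalSpace.SeparableSpace H] (h : IsRadonNikodym m μ γ)
    (h' : IsRadonNikodym m μ' γ') : μ = μ' := by
  obtain ⟨s, b, -⟩ := exists_hilbertBasis ℂ H
  have := countable_of_orthonormal b.orthonormal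
  exact Measure.ext fun S hS => by rw [h.measure_apply b hS, h'.measure_apply b hS]

/-- Each matrix element is determined almost everywhere by its integrals. A countable dense set of
vectors gives one common null set, and continuity extends the equality to all vectors. -/
theorem IsRadonNikodym.density_ae_eq [TopologicalSpace.SeparableSpace H]
    (h : IsRadonNikodym m μ γ) (h' : IsRadonNikodym m μ γ') : ∀ᵐ z ∂μ, γ z = γ' z := by
  have := h.prob
  have hpair : ∀ φ χ : H, ∀ᵐ z ∂μ, ⟪φ, γ z χ⟫_ℂ = ⟪φ, γ' z χ⟫_ℂ := fun φ χ =>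
    Integrable.ae_eq_of_forall_setIntegral_eq _ _ (h.integrable_inner φ χ)
      (h'.integrable_inner φ χ) fun S hS _ => by
        rw [← h.eq_integral S hS, ← h'.eq_integral S hS]
  have hall : ∀ᵐ z ∂μ, ∀ i j : ℕ,
      ⟪TopologicalSpace.denseSeq H i, γ z (TopologicalSpace.denseSeq H j)⟫_ℂ
        = ⟪TopologicalSpace.denseSeq H i, γ' z (TopologicalSpace.denseSeq H j)⟫_ℂ :=
    ae_all_iff.2 fun i => ae_all_iff.2 fun j => hpair _ _
  have hd := TopologicalSpace.denseRange_denseSeq H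
  filter_upwards [hall] with z hz
  refine ContinuousLinearMap.coeFn_injective ?_
  refine hd.equalizer (γ z).continuous (γ' z).continuous (funext fun j => ?_)
  refine ext_inner_left ℂ fun x => ?_
  have hc : ∀ y : H, Continuous fun x : H => ⟪x, y⟫_ℂ := fun y => by fun_prop
  exact congrFun (hd.equalizer (hc _) (hc _) (funext fun i => hz i j)) x

end RadonNikodym

/-! ### Averages of energies -/

section Averages

variable {H : Type*} [NormedAddCommGroup H] [InnerProductSpace ℂ H]
variable {K : Type*} [MeasurableSpace K]

theorem IsFin.coe_toReal {a : EReal} (h : IsFin a) : (a.toReal : EReal) = a :=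
  EReal.coe_toReal h.2 h.1

theorem isFin_coe (r : ℝ) : IsFin (r : EReal) := ⟨EReal.coe_ne_bot r, EReal.coe_ne_top r⟩

theorem IsFin.le_toReal {a : EReal} (h : IsFin a) {e : ℝ} (he : (e : EReal) ≤ a) :
    e ≤ a.toReal := by
  rw [← h.coe_toReal] at he
  exact EReal.coe_le_coe_iff.1 he

/-- The bound is needed only at finite values: unless these have full measure, `extIntegral` is `⊤`.
-/
theorem le_extIntegral {μ : Measure K} [IsProbabilityMeasure μ] {f : K → EReal} {e : ℝ}
    (h : ∀ᵐ z ∂μ, IsFin (f z) → (e : EReal) ≤ f z) : (e : EReal) ≤ extIntegral μ f := by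
  unfold extIntegral
  split_ifs with hf
  · rw [EReal.coe_le_coe_iff]
    have := integral_mono_ae (integrable_const e) hf.2 (μ := μ) (by
      filter_upwards [h, hf.1] with z hz hz' using hz'.le_toReal (hz hz'))
    simpa using this
  · exact le_top

/-- The nonnegative function `f - e` has integral zero. -/
theorem ae_eq_of_extIntegral_eq {μ : Measure K} [IsProbabilityMeasure μ] {f : K → EReal} {e : ℝ}
    (h : ∀ᵐ z ∂μ, IsFin (f z) → (e : EReal) ≤ f z) (he : extIntegral μ f = e) :
    ∀ᵐ z ∂μ, f z = e := by
  unfold extIntegral at he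
  split_ifs at he with hf
  · have he' := EReal.coe_injective he
    have h0 : ∫ z, ((f z).toReal - e) ∂μ = 0 := by
      rw [integral_sub hf.2 (integrable_const e), he']
      simp
    have hnn : 0 ≤ᵐ[μ] fun z => (f z).toReal - e := by
      filter_upwards [h, hf.1] with z hz hz' using sub_nonneg.2 (hz'.le_toReal (hz hz'))
    have hz := (integral_eq_zero_iff_of_nonneg_ae hnn (hf.2.sub (integrable_const e))).1 h0
    filter_upwards [hz, hf.1] with z h1 h2
    rw [← h2.coe_toReal, sub_eq_zero.1 h1]
  · exact absurd he.symm (EReal.coe_ne_top e)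

/-- Every function is almost everywhere constant for a Dirac measure, so no measurability of `f`
enters. -/
theorem extIntegral_dirac [MeasurableSingletonClass K] {f : K → EReal} {z : K}
    (hf : IsFin (f z)) : extIntegral (Measure.dirac z) f = f z := by
  unfold extIntegral
  rw [if_pos, integral_dirac, hf.coe_toReal]
  refine ⟨by simpa [ae_dirac_eq] using hf, ?_⟩
  refine (integrable_const (f z).toReal).congr ?_
  rw [EventuallyEq, ae_dirac_eq]
  simp

theorem le_extSum {w : ℕ → ℝ} (hw : ∀ k, 0 ≤ w k) (hw1 : HasSum w 1) {f : ℕ → EReal} {e : ℝ}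
    (h : ∀ k, w k ≠ 0 → IsFin (f k) → (e : EReal) ≤ f k) : (e : EReal) ≤ extSum w f := by
  unfold extSum
  split_ifs with hf
  · rw [EReal.coe_le_coe_iff]
    have h1 : HasSum (fun k => w k * e) e := by simpa using hw1.mul_right e
    refine hasSum_le (fun k => ?_) h1 hf.2.hasSum
    by_cases hk : w k = 0
    · simp [hk]
    · exact mul_le_mul_of_nonneg_left ((hf.1 k hk).le_toReal (h k hk (hf.1 k hk))) (hw k)
  · exact le_top

/-- The discrete counterpart of `ae_eq_of_extIntegral_eq`. -/
theorem eq_of_extSum_eq {w : ℕ → ℝ} (hw : ∀ k, 0 ≤ w k) (hw1 : HasSum w 1) {f : ℕ → EReal} {e : ℝ}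
    (h : ∀ k, w k ≠ 0 → IsFin (f k) → (e : EReal) ≤ f k) (he : extSum w f = e) :
    ∀ k, w k ≠ 0 → f k = e := by
  unfold extSum at he
  split_ifs at he with hf
  · have he' := EReal.coe_injective he
    have h1 : HasSum (fun k => w k * e) e := by simpa using hw1.mul_right e
    have h2 : HasSum (fun k => w k * (f k).toReal) e := by
      have := hf.2.hasSum
      rwa [he'] at this
    have h3 : HasSum (fun k => w k * (f k).toReal - w k * e) 0 := by simpa using h2.sub h1
    have hnn : ∀ k, 0 ≤ w k * (f k).toReal - w k * e := by
      intro k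
      by_cases hk : w k = 0
      · simp [hk]
      · rw [← mul_sub]
        exact mul_nonneg (hw k) (sub_nonneg.2 ((hf.1 k hk).le_toReal (h k hk (hf.1 k hk))))
    have hz := (hasSum_zero_iff_of_nonneg hnn).1 h3
    intro k hk
    have hk0 := congrFun hz k
    simp only [Pi.zero_apply, ← mul_sub] at hk0
    rw [← (hf.1 k hk).coe_toReal, sub_eq_zero.1 ((mul_eq_zero.1 hk0).resolve_left hk)]
  · exact absurd he.symm (EReal.coe_ne_top e)

theorem extSum_eq_of_forall_eq {w : ℕ → ℝ} (hw1 : HasSum w 1) {f : ℕ → EReal} {e : ℝ}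
    (h : ∀ k, w k ≠ 0 → f k = e) : extSum w f = e := by
  have hterm : (fun k => w k * (f k).toReal) = fun k => w k * e := by
    funext k
    by_cases hk : w k = 0
    · simp [hk]
    · rw [h k hk, EReal.toReal_coe]
  have hs : HasSum (fun k => w k * e) e := by simpa using hw1.mul_right e
  unfold extSum
  rw [if_pos ⟨fun k hk => by rw [h k hk]; exact isFin_coe e, hterm ▸ hs.summable⟩, hterm, hs.tsum_eq]

variable [CompleteSpace H]

theorem le_traceForm {γ : H →L[ℂ] H} (hγ : IsDensityMatrix γ) {q : H → EReal} {e : ℝ}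
    (h : ∀ ψ, ‖ψ‖ = 1 → IsFin (q ψ) → (e : EReal) ≤ q ψ) : (e : EReal) ≤ traceForm q γ := by
  unfold traceForm
  split_ifs with hd
  · have hs := hd.choose_spec
    exact le_extSum hs.nonneg (hs.hasSum_weights hγ) fun k hk hfin =>
      h _ (hs.orthonormal.1 ⟨k, hk⟩) hfin
  · exact le_top

theorem exists_spectralDecomposition_of_traceForm_eq {γ : H →L[ℂ] H} (hγ : IsDensityMatrix γ)
    {q : H → EReal} {e : ℝ} (h : ∀ ψ, ‖ψ‖ = 1 → IsFin (q ψ) → (e : EReal) ≤ q ψ)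
    (he : traceForm q γ = e) :
    ∃ w ψ, IsSpectralDecomposition γ w ψ ∧ HasSum w 1 ∧ ∀ k, w k ≠ 0 → q (ψ k) = e := by
  unfold traceForm at he
  split_ifs at he with hd
  · have hs := hd.choose_spec
    have hw := hs.hasSum_weights hγ
    exact ⟨_, _, hs, hw, eq_of_extSum_eq hs.nonneg hw
      (fun k hk hfin => h _ (hs.orthonormal.1 ⟨k, hk⟩) hfin) he⟩
  · exact absurd he.symm (EReal.coe_ne_top e)

/-- Whichever decomposition `traceForm` selects, its vectors of nonzero weight are eigenvectors of
the projection, hence `ψ` up to a phase, and `q` ignores phases. -/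
theorem traceForm_rankOne {ψ : H} (hψ : ‖ψ‖ = 1) {q : H → EReal}
    (hq : ∀ c : ℂ, ‖c‖ = 1 → q (c • ψ) = q ψ) (hfin : IsFin (q ψ)) :
    traceForm q (InnerProductSpace.rankOne ℂ ψ ψ) = q ψ := by
  have hd : ∃ p : (ℕ → ℝ) × (ℕ → H),
      IsSpectralDecomposition (InnerProductSpace.rankOne ℂ ψ ψ) p.1 p.2 :=
    ⟨(_, _), isSpectralDecomposition_rankOne hψ⟩
  unfold traceForm
  rw [dif_pos hd]
  have hs := hd.choose_spec
  rw [← hfin.coe_toReal]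
  refine extSum_eq_of_forall_eq (hs.hasSum_weights (isDensityMatrix_rankOne hψ)) fun k hk => ?_
  rw [hfin.coe_toReal]
  have h1 := hs.apply_eigenvector hk
  rw [InnerProductSpace.rankOne_apply] at h1
  have hk' : (hd.choose.1 k : ℂ) ≠ 0 := by exact_mod_cast hk
  have h2 : hd.choose.2 k = ((hd.choose.1 k : ℂ)⁻¹ * ⟪ψ, hd.choose.2 k⟫_ℂ) • ψ := by
    rw [mul_smul, h1, smul_smul, inv_mul_cancel₀ hk', one_smul]
  have h3 : ‖hd.choose.2 k‖ = 1 := hs.orthonormal.1 ⟨k, hk⟩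
  rw [h2]
  refine hq _ ?_
  rw [h2, norm_smul, hψ, mul_one] at h3
  exact h3

end Averages

/-! ### Pure states -/

section Pure

variable {H : Type*} [NormedAddCommGroup H] [InnerProductSpace ℂ H] [CompleteSpace H]
variable {K : Type*} [MeasurableSpace K]

open Classical in
/-- The state-valued measure `|ψ⟩⟨ψ| δ_z`. -/
def pureState (ψ : H) (hψ : ‖ψ‖ = 1) (z : K) : StateValuedMeasure K H where
  toFun S := if z ∈ S then InnerProductSpace.rankOne ℂ ψ ψ else 0
  positive S _ := by
    split_ifs
    · exact InnerProductSpace.isPositive_rankOne_self ψ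
    · exact ContinuousLinearMap.isPositive_zero
  traceClass S _ := by
    split_ifs
    · rw [(isDensityMatrix_rankOne hψ).2]; exact ENNReal.one_lt_top
    · rw [traceNorm_zero]; exact ENNReal.zero_lt_top
  empty := by simp
  additive S _ hS := by
    refine tendsto_const_nhds.congr' ?_
    -- The partial sums are eventually exact: as soon as `F` contains the only index `n` with `z ∈ S
    -- n`.
    by_cases hz : ∃ n, z ∈ S n
    · obtain ⟨n, hn⟩ := hz
      filter_upwards [eventually_ge_atTop {n}] with F hF
      rw [if_pos (mem_iUnion.2 ⟨n, hn⟩), Finset.sum_eq_single n, if_pos hn, sub_self,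
        traceNorm_zero]
      · intro k _ hk
        exact if_neg fun hk' => Set.disjoint_left.1 (hS hk) hk' hn
      · intro h
        exact absurd (hF (Finset.mem_singleton_self n)) h
    · refine Eventually.of_forall fun F => ?_
      beta_reduce
      rw [if_neg (by simpa using hz), Finset.sum_eq_zero, sub_self, traceNorm_zero]
      exact fun k _ => if_neg fun hk => hz ⟨k, hk⟩
  normalized := by simpa using (isDensityMatrix_rankOne hψ).2

theorem isRadonNikodym_pureState [MeasurableSingletonClass K] (ψ : H) (hψ : ‖ψ‖ = 1) (z : K) :
    IsRadonNikodym (pureState ψ hψ z) (Measure.dirac z)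
      (fun _ => InnerProductSpace.rankOne ℂ ψ ψ) where
  prob := inferInstance
  density := Eventually.of_forall fun _ => isDensityMatrix_rankOne hψ
  measurable _ _ := aestronglyMeasurable_const
  eq_integral S hS φ χ := by
    by_cases hz : z ∈ S <;> simp [pureState, hz, hS, Measure.real]

end Pure

/-! ### Quadratic forms on a domain -/

section Quadratic

variable {H : Type*} [NormedAddCommGroup H] [InnerProductSpace ℂ H]

/-- `q` is a quadratic form with domain `D`. -/
structure IsQuadraticOn (D : Submodule ℂ H) (q : H → ℝ) : Prop where
  smul : ∀ (c : ℂ), ∀ ψ ∈ D, q (c • ψ) = ‖c‖ ^ 2 * q ψ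
  parallelogram : ∀ ψ ∈ D, ∀ φ ∈ D, q (ψ + φ) + q (ψ - φ) = 2 * q ψ + 2 * q φ

namespace IsQuadraticOn

variable {D : Submodule ℂ H} {q q₁ q₂ : H → ℝ}

theorem add (h₁ : IsQuadraticOn D q₁) (h₂ : IsQuadraticOn D q₂) :
    IsQuadraticOn D (fun ψ => q₁ ψ + q₂ ψ) where
  smul c ψ hψ := by rw [h₁.smul c ψ hψ, h₂.smul c ψ hψ]; ring
  parallelogram ψ hψ φ hφ := by
    linarith [h₁.parallelogram ψ hψ φ hφ, h₂.parallelogram ψ hψ φ hφ]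

theorem const_mul (c : ℝ) (h : IsQuadraticOn D q) : IsQuadraticOn D (fun ψ => c * q ψ) where
  smul a ψ hψ := by rw [h.smul a ψ hψ]; ring
  parallelogram ψ hψ φ hφ := by linear_combination c * h.parallelogram ψ hψ φ hφ

theorem sub (h₁ : IsQuadraticOn D q₁) (h₂ : IsQuadraticOn D q₂) :
    IsQuadraticOn D (fun ψ => q₁ ψ - q₂ ψ) := by
  simpa [sub_eq_add_neg] using h₁.add (h₂.const_mul (-1))

theorem sum {ι : Type*} (s : Finset ι) {p : ι → H → ℝ} (h : ∀ i ∈ s, IsQuadraticOn D (p i)) :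
    IsQuadraticOn D (fun ψ => ∑ i ∈ s, p i ψ) where
  smul c ψ hψ := by
    rw [Finset.mul_sum]
    exact Finset.sum_congr rfl fun i hi => (h i hi).smul c ψ hψ
  parallelogram ψ hψ φ hφ := by
    rw [← Finset.sum_add_distrib, Finset.mul_sum, Finset.mul_sum, ← Finset.sum_add_distrib]
    exact Finset.sum_congr rfl fun i hi => (h i hi).parallelogram ψ hψ φ hφ

theorem norm_sq (D : Submodule ℂ H) : IsQuadraticOn D (fun ψ => ‖ψ‖ ^ 2) where
  smul c ψ _ := by rw [norm_smul, mul_pow]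
  parallelogram ψ _ φ _ := by
    have := parallelogram_law_with_norm ℂ ψ φ
    simp only [sq]
    linarith

theorem congr (h : IsQuadraticOn D q₁) (he : ∀ ψ ∈ D, q₂ ψ = q₁ ψ) : IsQuadraticOn D q₂ where
  smul c ψ hψ := by rw [he _ hψ, he _ (D.smul_mem c hψ), h.smul c ψ hψ]
  parallelogram ψ hψ φ hφ := by
    rw [he _ hψ, he _ hφ, he _ (D.add_mem hψ hφ), he _ (D.sub_mem hψ hφ), h.parallelogram ψ hψ φ hφ]

/-- The null space of a nonnegative quadratic form. -/
def nullSpace (h : IsQuadraticOn D q) (h0 : ∀ ψ ∈ D, 0 ≤ q ψ) : Submodule ℂ H where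
  carrier := {ψ | ψ ∈ D ∧ q ψ = 0}
  zero_mem' := ⟨D.zero_mem, by simpa using h.smul 0 0 D.zero_mem⟩
  smul_mem' c ψ hψ := ⟨D.smul_mem c hψ.1, by rw [h.smul c ψ hψ.1, hψ.2, mul_zero]⟩
  add_mem' {ψ φ} hψ hφ := by
    refine ⟨D.add_mem hψ.1 hφ.1, ?_⟩
    -- The values at `ψ + φ` and `ψ - φ` are nonnegative with sum zero.
    have h1 := h.parallelogram ψ hψ.1 φ hφ.1
    have h2 := h0 _ (D.add_mem hψ.1 hφ.1)
    have h3 := h0 _ (D.sub_mem hψ.1 hφ.1)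
    rw [hψ.2, hφ.2] at h1
    linarith

theorem mul_norm_sq_le (h : IsQuadraticOn D q) {e : ℝ} (he : ∀ ψ ∈ D, ‖ψ‖ = 1 → e ≤ q ψ) {ψ : H}
    (hψ : ψ ∈ D) : e * ‖ψ‖ ^ 2 ≤ q ψ := by
  by_cases h0 : ψ = 0
  · have := h.smul 0 ψ hψ
    subst h0
    simpa using this.ge
  have hn : 0 < ‖ψ‖ := norm_pos_iff.2 h0
  have hu : ‖((‖ψ‖⁻¹ : ℝ) : ℂ) • ψ‖ = 1 := by
    rw [norm_smul, Complex.norm_real, norm_inv, norm_norm, inv_mul_cancel₀ hn.ne']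
  have h1 := he _ (D.smul_mem _ hψ) hu
  rw [h.smul _ ψ hψ, Complex.norm_real, norm_inv, norm_norm, inv_pow, inv_mul_eq_div,
    le_div_iff₀ (by positivity)] at h1
  exact h1

/-- The vectors at which a quadratic form attains its lower bound form a linear space. -/
theorem eq_of_mem_span (h : IsQuadraticOn D q) {e : ℝ} (he : ∀ ψ ∈ D, ‖ψ‖ = 1 → e ≤ q ψ)
    {s : Set H} (hs : ∀ ψ ∈ s, ψ ∈ D ∧ q ψ = e * ‖ψ‖ ^ 2) {φ : H} (hφ : φ ∈ Submodule.span ℂ s) :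
    φ ∈ D ∧ q φ = e * ‖φ‖ ^ 2 := by
  -- The form `q - e‖·‖²` is nonnegative by homogeneity, and its null space is the space in
  -- question.
  have h' := h.sub ((norm_sq D).const_mul e)
  have h0 : ∀ ψ ∈ D, 0 ≤ q ψ - e * ‖ψ‖ ^ 2 := fun ψ hψ => sub_nonneg.2 (h.mul_norm_sq_le he hψ)
  have hle : Submodule.span ℂ s ≤ h'.nullSpace h0 :=
    Submodule.span_le.2 fun ψ hψ => ⟨(hs ψ hψ).1, sub_eq_zero.2 (hs ψ hψ).2⟩
  exact ⟨(hle hφ).1, sub_eq_zero.1 (hle hφ).2⟩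

end IsQuadraticOn

/-- The energy `E ψ z` is, for each `z`, the quadratic form `q z` on its domain `D`, and `+∞` outside
of it. -/
structure IsQuadraticEnergy {K : Type*} (D : Submodule ℂ H) (q : K → H → ℝ)
    (E : H → K → EReal) : Prop where
  quadratic : ∀ z, IsQuadraticOn D (q z)
  eq_coe : ∀ ψ ∈ D, ∀ z, E ψ z = q z ψ
  eq_top : ∀ ψ ∉ D, ∀ z, E ψ z = ⊤

namespace IsQuadraticEnergy

variable {K : Type*} {D : Submodule ℂ H} {q : K → H → ℝ} {E : H → K → EReal}

theorem isFin_iff (hE : IsQuadraticEnergy D q E) (ψ : H) (z : K) : IsFin (E ψ z) ↔ ψ ∈ D := by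
  constructor
  · intro h
    by_contra hψ
    exact h.2 (hE.eq_top ψ hψ z)
  · intro hψ
    rw [hE.eq_coe ψ hψ z]
    exact isFin_coe _

theorem smul_phase (hE : IsQuadraticEnergy D q E) {c : ℂ} (hc : ‖c‖ = 1) (ψ : H) (z : K) :
    E (c • ψ) z = E ψ z := by
  have hc0 : c ≠ 0 := by
    rintro rfl
    simp at hc
  by_cases hψ : ψ ∈ D
  · rw [hE.eq_coe _ (D.smul_mem c hψ), hE.eq_coe ψ hψ, (hE.quadratic z).smul c ψ hψ, hc]
    simp
  · rw [hE.eq_top ψ hψ, hE.eq_top _ fun h => hψ ((D.smul_mem_iff hc0).1 h)]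

theorem eq_of_mem_span (hE : IsQuadraticEnergy D q E) {z : K} {e : ℝ}
    (he : ∀ ψ, ‖ψ‖ = 1 → IsFin (E ψ z) → (e : EReal) ≤ E ψ z) {s : Set H}
    (hs : ∀ ψ ∈ s, ‖ψ‖ = 1 ∧ E ψ z = e) {φ : H} (hφ : φ ∈ Submodule.span ℂ s) (hφ1 : ‖φ‖ = 1) :
    E φ z = e := by
  have hD : ∀ ψ ∈ s, ψ ∈ D := fun ψ hψ => (hE.isFin_iff ψ z).1 ((hs ψ hψ).2 ▸ isFin_coe e)
  have h := (hE.quadratic z).eq_of_mem_span (e := e)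
    (fun ψ hψ h1 => by
      have := he ψ h1 ((hE.isFin_iff ψ z).2 hψ)
      rw [hE.eq_coe ψ hψ] at this
      exact EReal.coe_le_coe_iff.1 this)
    (fun ψ hψ => ⟨hD ψ hψ, by
      have := (hs ψ hψ).2
      rw [hE.eq_coe ψ (hD ψ hψ)] at this
      rw [(hs ψ hψ).1, EReal.coe_injective this]
      simp⟩) hφ
  rw [hE.eq_coe φ h.1, h.2, hφ1]
  simp

end IsQuadraticEnergy

end Quadratic

/-! ### Equivalence of the variational problems -/

section Variational

theorem isMinimizer_iff {α : Type*} {D : Set α} {F : α → EReal} {a : α} :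
    IsMinimizer D F a ↔ a ∈ D ∧ ∀ b ∈ D, F a ≤ F b := by
  refine and_congr_right fun ha => ⟨fun h b hb => ?_, fun h => le_antisymm ?_ ?_⟩
  · rw [h]
    exact iInf₂_le b hb
  · exact le_iInf₂ h
  · exact iInf₂_le a ha

variable {H : Type*} [NormedAddCommGroup H] {K : Type*} {E : H → K → EReal}

/-- `e` is a lower bound of the energy of normalized states. -/
def IsLowerBound (E : H → K → EReal) (e : ℝ) : Prop :=
  ∀ ψ z, ‖ψ‖ = 1 → IsFin (E ψ z) → (e : EReal) ≤ E ψ z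

theorem isQcMinimizer_of_isLowerBound {e : ℝ} (he : IsLowerBound E e) {ψ : H} (hψ : ‖ψ‖ = 1) {z : K}
    (h : E ψ z = e) : IsQcMinimizer E (ψ, z) := by
  refine isMinimizer_iff.2 ⟨⟨hψ, h ▸ isFin_coe e⟩, fun p hp => ?_⟩
  exact h.trans_le (he p.1 p.2 hp.1 hp.2)

/-- The finite value at a minimizer supplies the real lower bound on which all comparisons rest. -/
theorem IsQcMinimizer.isLowerBound {ψ : H} {z : K} (h : IsQcMinimizer E (ψ, z)) :
    ∃ e : ℝ, E ψ z = e ∧ IsLowerBound E e := by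
  obtain ⟨⟨_, hf⟩, hm⟩ := isMinimizer_iff.1 h
  refine ⟨(E ψ z).toReal, hf.coe_toReal.symm, fun φ y h1 h2 => ?_⟩
  rw [hf.coe_toReal]
  exact hm (φ, y) ⟨h1, h2⟩

variable [InnerProductSpace ℂ H] [CompleteSpace H] [MeasurableSpace K]
variable {D : Submodule ℂ H} {q : K → H → ℝ}

theorem le_svmEnergy {e : ℝ} (he : IsLowerBound E e) (m : StateValuedMeasure K H) :
    (e : EReal) ≤ svmEnergy E m := by
  unfold svmEnergy
  split_ifs with h
  · have hrn := h.choose_spec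
    have := hrn.prob
    exact le_extIntegral (hrn.density.mono fun z hz _ => le_traceForm hz fun ψ h1 h2 => he ψ z h1 h2)
  · exact le_top

/-- Equality in the average over `z` forces equality of almost every trace, and equality in the
trace forces it at every eigenvector of nonzero weight. -/
theorem exists_isRadonNikodym_of_svmEnergy_eq {e : ℝ} (he : IsLowerBound E e)
    {m : StateValuedMeasure K H} (hm : svmEnergy E m = e) :
    ∃ μ γ, IsRadonNikodym m μ γ ∧ ∀ᵐ z ∂μ, ∃ w ψ, IsSpectralDecomposition (γ z) w ψ ∧
      HasSum w 1 ∧ ∀ k, w k ≠ 0 → E (ψ k) z = e := by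
  unfold svmEnergy at hm
  split_ifs at hm with h
  · have hrn := h.choose_spec
    have := hrn.prob
    refine ⟨_, _, hrn, ?_⟩
    have hae := ae_eq_of_extIntegral_eq
      (hrn.density.mono fun z hz _ => le_traceForm hz fun ψ h1 h2 => he ψ z h1 h2) hm
    filter_upwards [hae, hrn.density] with z h1 h2
    exact exists_spectralDecomposition_of_traceForm_eq h2 (fun ψ h3 h4 => he ψ z h3 h4) h1
  · exact absurd hm.symm (EReal.coe_ne_top e)

/-- Uniqueness identifies the decomposition chosen in `svmEnergy`: its measure is `δ_z`, and almost
everywhere then means at `z`. -/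
theorem svmEnergy_pureState [TopologicalSpace.SeparableSpace H] [MeasurableSingletonClass K]
    (hE : IsQuadraticEnergy D q E) {ψ : H} (hψ : ‖ψ‖ = 1) {z : K} (hf : IsFin (E ψ z)) :
    svmEnergy E (pureState ψ hψ z) = E ψ z := by
  have hp := isRadonNikodym_pureState ψ hψ z
  have h : ∃ p : Measure K × (K → H →L[ℂ] H), IsRadonNikodym (pureState ψ hψ z) p.1 p.2 :=
    ⟨(_, _), hp⟩
  unfold svmEnergy
  rw [dif_pos h]
  have hrn := h.choose_spec
  have hμ : h.choose.1 = Measure.dirac z := hrn.measure_eq hp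
  rw [hμ] at hrn ⊢
  have hγ : h.choose.2 z = InnerProductSpace.rankOne ℂ ψ ψ := by
    have := hrn.density_ae_eq hp
    rw [ae_dirac_eq] at this
    exact this
  have ht : traceForm (fun φ => E φ z) (h.choose.2 z) = E ψ z := by
    rw [hγ]
    exact traceForm_rankOne hψ (fun c hc => hE.smul_phase hc ψ z) hf
  rw [extIntegral_dirac (f := fun z => traceForm (fun ψ => E ψ z) (h.choose.2 z)) (ht ▸ hf), ht]

/-- Pure states are competitors of `m`, so its energy bounds `E` from below. -/
theorem IsSvmMinimizer.isLowerBound [TopologicalSpace.SeparableSpace H]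
    [MeasurableSingletonClass K] (hE : IsQuadraticEnergy D q E) {m : StateValuedMeasure K H}
    (hm : IsSvmMinimizer E m) : ∃ e : ℝ, svmEnergy E m = e ∧ IsLowerBound E e := by
  obtain ⟨hf, hmin⟩ := isMinimizer_iff.1 hm
  have hf' : IsFin (svmEnergy E m) := hf
  refine ⟨(svmEnergy E m).toReal, hf'.coe_toReal.symm, fun ψ z h1 h2 => ?_⟩
  have hp := svmEnergy_pureState hE h1 h2
  rw [hf'.coe_toReal, ← hp]
  exact hmin _ (show IsFin _ from hp.symm ▸ h2)

/-- For a degenerate eigenvalue an eigenvector need not occur in the chosen decomposition; the span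
argument covers it. -/
theorem isConcentratedOnMinimizers [TopologicalSpace.SeparableSpace H]
    [MeasurableSingletonClass K] (hE : IsQuadraticEnergy D q E) {m : StateValuedMeasure K H}
    (hm : IsSvmMinimizer E m) : IsConcentratedOnMinimizers E m := by
  obtain ⟨e, hme, he⟩ := hm.isLowerBound hE
  obtain ⟨μ, γ, hrn, hae⟩ := exists_isRadonNikodym_of_svmEnergy_eq he hme
  refine ⟨⟨μ, γ, hrn⟩, fun μ' γ' hrn' => ?_⟩
  obtain rfl := hrn.measure_eq hrn'
  filter_upwards [hae, hrn.density_ae_eq hrn'] with z ⟨w, ψ, hs, hw, hψ⟩ hγ φ c hφ hc hev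
  rw [← hγ] at hev
  refine isQcMinimizer_of_isLowerBound he hφ ?_
  refine hE.eq_of_mem_span (fun χ h1 h2 => he χ z h1 h2) ?_
    (hs.mem_span_of_eigenvector hw.summable hc hev) hφ
  rintro _ ⟨k, hk, rfl⟩
  exact ⟨hs.orthonormal.1 ⟨k, hk⟩, hψ k hk⟩

/-- The four variational problems have minimizers simultaneously, where `P` is a functional whose
value at `ψ` is attained by the energy and is a lower bound for it. -/
theorem tfae_exists_minimizer [TopologicalSpace.SeparableSpace H] [MeasurableSingletonClass K]
    (hE : IsQuadraticEnergy D q E) {P : H → EReal}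
    (hP : ∀ ψ, ‖ψ‖ = 1 → IsFin (P ψ) → ∃ z, P ψ = E ψ z)
    (hP' : ∀ ψ z, ‖ψ‖ = 1 → IsFin (E ψ z) → IsFin (P ψ) ∧ P ψ ≤ E ψ z) :
    [∃ p, IsQcMinimizer E p, ∃ ψ, IsPekarMinimizer P ψ, ∃ m, IsSvmMinimizer E m,
      ∃ p, IsPmMinimizer E p].TFAE := by
  tfae_have 1 → 2 := by
    rintro ⟨⟨ψ, z⟩, h⟩
    obtain ⟨⟨h1, hf⟩, hm⟩ := isMinimizer_iff.1 h
    refine ⟨ψ, isMinimizer_iff.2 ⟨⟨h1, (hP' ψ z h1 hf).1⟩, fun φ hφ => ?_⟩⟩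
    obtain ⟨y, hy⟩ := hP φ hφ.1 hφ.2
    rw [hy]
    exact (hP' ψ z h1 hf).2.trans (hm (φ, y) ⟨hφ.1, show IsFin (E φ y) from hy ▸ hφ.2⟩)
  tfae_have 2 → 1 := by
    rintro ⟨ψ, h⟩
    obtain ⟨⟨h1, hf⟩, hm⟩ := isMinimizer_iff.1 h
    obtain ⟨z, hz⟩ := hP ψ h1 hf
    refine ⟨(ψ, z), isMinimizer_iff.2 ⟨⟨h1, show IsFin (E ψ z) from hz ▸ hf⟩, fun p hp => ?_⟩⟩
    have h2 := hP' p.1 p.2 hp.1 hp.2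
    exact hz.symm.trans_le ((hm p.1 ⟨hp.1, h2.1⟩).trans h2.2)
  tfae_have 1 → 3 := by
    rintro ⟨⟨ψ, z⟩, h⟩
    obtain ⟨e, hψe, he⟩ := h.isLowerBound
    have hp := svmEnergy_pureState hE h.1.1 h.1.2
    refine ⟨pureState ψ h.1.1 z, isMinimizer_iff.2 ⟨show IsFin _ from hp.symm ▸ h.1.2,
      fun m _ => ?_⟩⟩
    exact (hp.trans hψe).trans_le (le_svmEnergy he m)
  tfae_have 3 → 1 := by
    rintro ⟨m, hm⟩
    obtain ⟨e, hme, he⟩ := hm.isLowerBound hE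
    obtain ⟨μ, γ, hrn, hae⟩ := exists_isRadonNikodym_of_svmEnergy_eq he hme
    have := hrn.prob
    obtain ⟨z, w, ψ, hs, hw, hψ⟩ := hae.exists
    -- The weights sum to one, so they do not all vanish.
    obtain ⟨k, hk⟩ : ∃ k, w k ≠ 0 := by
      by_contra! h0
      have : w = 0 := funext h0
      subst this
      exact zero_ne_one (hasSum_zero.unique hw)
    exact ⟨(ψ k, z), isQcMinimizer_of_isLowerBound he (hs.orthonormal.1 ⟨k, hk⟩) (hψ k hk)⟩
  tfae_have 1 → 4 := by
    rintro ⟨⟨ψ, z⟩, h⟩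
    obtain ⟨e, hψe, he⟩ := h.isLowerBound
    have hp : pmEnergy E (ψ, Measure.dirac z) = E ψ z := extIntegral_dirac h.1.2
    refine ⟨(ψ, Measure.dirac z), isMinimizer_iff.2
      ⟨⟨h.1.1, inferInstance, show IsFin _ from hp.symm ▸ h.1.2⟩, fun p hp' => ?_⟩⟩
    have := hp'.2.1
    exact (hp.trans hψe).trans_le (le_extIntegral (Eventually.of_forall fun y hy => he _ y hp'.1 hy))
  tfae_have 4 → 1 := by
    rintro ⟨⟨ψ, μ⟩, h⟩
    obtain ⟨⟨h1, h2, hf⟩, hm⟩ := isMinimizer_iff.1 h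
    have h2' : IsProbabilityMeasure μ := h2
    -- The pairs `(φ, δ_y)` are competitors.
    have he : IsLowerBound E (pmEnergy E (ψ, μ)).toReal := by
      intro φ y h3 h4
      have hp : pmEnergy E (φ, Measure.dirac y) = E φ y := extIntegral_dirac h4
      rw [hf.coe_toReal, ← hp]
      exact hm _ ⟨h3, inferInstance, show IsFin _ from hp.symm ▸ h4⟩
    obtain ⟨z, hz⟩ := (ae_eq_of_extIntegral_eq (μ := μ)
      (Eventually.of_forall fun y hy => he ψ y h1 hy) hf.coe_toReal.symm).exists
    exact ⟨(ψ, z), isQcMinimizer_of_isLowerBound he h1 hz⟩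
  tfae_finish

end Variational

/-! ### Minimization over the field -/

section ConvexQuadratic

attribute [local instance] InnerProductSpace.complexToReal

variable {K : Type*} [NormedAddCommGroup K] [InnerProductSpace ℂ K]

/-- `f` is a real polynomial of degree two on `K` with nonnegative quadratic part. -/
def IsConvexQuadratic (f : K → ℝ) : Prop :=
  ∃ (c : ℝ) (ℓ : K →L[ℝ] ℝ) (B : K →L[ℝ] K →L[ℝ] ℝ),
    (∀ z w, B z w = B w z) ∧ (∀ z, 0 ≤ B z z) ∧ ∀ z, f z = c + ℓ z + B z z

namespace IsConvexQuadratic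

variable {f g : K → ℝ}

theorem const (c : ℝ) : IsConvexQuadratic (fun _ : K => c) :=
  ⟨c, 0, 0, by simp, by simp, by simp⟩

theorem linear (ℓ : K →L[ℝ] ℝ) : IsConvexQuadratic (fun z => ℓ z) :=
  ⟨0, ℓ, 0, by simp, by simp, by simp⟩

theorem add (hf : IsConvexQuadratic f) (hg : IsConvexQuadratic g) :
    IsConvexQuadratic (fun z => f z + g z) := by
  obtain ⟨c, ℓ, B, hs, hn, h⟩ := hf
  obtain ⟨c', ℓ', B', hs', hn', h'⟩ := hg
  refine ⟨c + c', ℓ + ℓ', B + B', fun z w => ?_, fun z => ?_, fun z => ?_⟩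
  · simp [hs z w, hs' z w]
  · simpa using add_nonneg (hn z) (hn' z)
  · beta_reduce
    rw [h, h']
    simp only [_root_.add_apply]
    ring

theorem const_mul {a : ℝ} (ha : 0 ≤ a) (hf : IsConvexQuadratic f) :
    IsConvexQuadratic (fun z => a * f z) := by
  obtain ⟨c, ℓ, B, hs, hn, h⟩ := hf
  refine ⟨a * c, a • ℓ, a • B, fun z w => ?_, fun z => ?_, fun z => ?_⟩
  · simp [hs z w]
  · simpa using mul_nonneg ha (hn z)
  · beta_reduce
    rw [h]
    simp only [_root_.smul_apply, smul_eq_mul]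
    ring

theorem sum {ι : Type*} (s : Finset ι) {p : ι → K → ℝ} (h : ∀ i ∈ s, IsConvexQuadratic (p i)) :
    IsConvexQuadratic (fun z => ∑ i ∈ s, p i z) := by
  classical
  induction s using Finset.induction_on with
  | empty => simpa using const 0
  | insert i s hi ih =>
    simp_rw [Finset.sum_insert hi]
    exact (h i (Finset.mem_insert_self i s)).add (ih fun j hj => h j (Finset.mem_insert_of_mem hj))

variable {H : Type*} [NormedAddCommGroup H] [InnerProductSpace ℂ H]

theorem re_inner (u : H) (S : K →L[ℝ] H) : IsConvexQuadratic (fun z => (⟪u, S z⟫_ℂ).re) :=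
  linear ((innerSL ℝ u).comp S)

theorem norm_sq_add (u : H) (S : K →L[ℝ] H) : IsConvexQuadratic (fun z => ‖u + S z‖ ^ 2) := by
  refine ⟨‖u‖ ^ 2, (2 : ℝ) • (innerSL ℝ u).comp S, (innerSL ℝ).bilinearComp S S, fun z w => ?_,
    fun z => ?_, fun z => ?_⟩
  · simp [real_inner_comm]
  · simp
  · beta_reduce
    rw [norm_add_sq_real]
    simp

variable [CompleteSpace K]

/-- Adding `‖z‖²` makes the critical points exist, and every critical point is a minimizer. -/
theorem critical_add_norm_sq (hf : IsConvexQuadratic f) :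
    (∃ z, ∀ v : K, HasDerivAt
      (fun t : ℝ => f (z + (t : ℂ) • v) + ‖z + (t : ℂ) • v‖ ^ 2) 0 0) ∧
    ∀ z, (∀ v : K, HasDerivAt
      (fun t : ℝ => f (z + (t : ℂ) • v) + ‖z + (t : ℂ) • v‖ ^ 2) 0 0) →
      ∀ y, f z + ‖z‖ ^ 2 ≤ f y + ‖y‖ ^ 2 := by
  obtain ⟨c, ℓ, B₀, hs₀, hn₀, h⟩ := hf
  obtain ⟨J, hJ⟩ : ∃ J : K →L[ℝ] K →L[ℝ] ℝ, ∀ x y, J x y = ⟪x, y⟫_ℝ :=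
    ⟨innerSL ℝ, fun _ _ => rfl⟩
  set B : K →L[ℝ] K →L[ℝ] ℝ := B₀ + J with hB
  have hs : ∀ z w, B z w = B w z := by
    intro z w
    simp [hB, hJ, hs₀ z w, real_inner_comm]
  have hn : ∀ z, ‖z‖ ^ 2 ≤ B z z := by
    intro z
    simpa [hB, hJ] using hn₀ z
  -- The second order expansion is exact. It gives the derivative at `t = 0` and, at `t = 1`, the
  -- comparison of a critical point with any other point.
  have hexp : ∀ z v : K, ∀ t : ℝ, f (z + (t : ℂ) • v) + ‖z + (t : ℂ) • v‖ ^ 2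
      = f z + ‖z‖ ^ 2 + t * (ℓ v + 2 * B z v) + t ^ 2 * B v v := by
    have hval : ∀ z, f z + ‖z‖ ^ 2 = c + ℓ z + B z z := by
      intro z
      rw [h z]
      simp [hB, hJ]
      ring
    intro z v t
    rw [hval, hval, Complex.coe_smul]
    simp only [map_add, map_smul, _root_.add_apply, _root_.smul_apply,
      smul_eq_mul]
    rw [hs v z]
    ring
  have hderiv : ∀ z v : K, HasDerivAt
      (fun t : ℝ => f (z + (t : ℂ) • v) + ‖z + (t : ℂ) • v‖ ^ 2) (ℓ v + 2 * B z v) 0 := by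
    intro z v
    simp_rw [hexp z v]
    have h1 := (((hasDerivAt_id (0 : ℝ)).mul_const (ℓ v + 2 * B z v)).const_add
      (f z + ‖z‖ ^ 2)).add (((hasDerivAt_id (0 : ℝ)).pow 2).mul_const (B v v))
    simpa [Pi.add_def] using h1
  constructor
  -- Since `B ≥ ‖·‖²`, Lax-Milgram solves `2 B z = -ℓ`, with `ℓ` represented by a vector through
  -- Riesz.
  · have hco : IsCoercive B := ⟨1, one_pos, fun u => by
      have := hn u
      rw [sq] at this
      simpa using this⟩
    refine ⟨hco.continuousLinearEquivOfBilin.symm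
      ((-(1 / 2) : ℝ) • (InnerProductSpace.toDual ℝ K).symm ℓ), fun v => ?_⟩
    convert hderiv _ v using 1
    rw [← hco.continuousLinearEquivOfBilin_apply, ContinuousLinearEquiv.apply_symm_apply,
      real_inner_smul_left, InnerProductSpace.toDual_symm_apply]
    ring
  · intro z hz y
    -- Only the nonnegative remainder `B (y - z) (y - z)` is left in the expansion.
    have hcrit : ℓ (y - z) + 2 * B z (y - z) = 0 := (hderiv z (y - z)).unique (hz (y - z))
    have h1 := hexp z (y - z) 1
    rw [hcrit] at h1
    simp only [Complex.ofReal_one, one_smul, add_sub_cancel] at h1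
    have h2 := (sq_nonneg ‖y - z‖).trans (hn (y - z))
    linarith

end IsConvexQuadratic

end ConvexQuadratic

/-! ### The field energy and the two Pekar functionals -/

section FieldEnergy

variable {H K : Type*} [NormedAddCommGroup H] [NormedAddCommGroup K]

/-- The form `f z` with the field energy `‖z‖²` added. -/
def withFieldEnergy (f : K → H → ℝ) (z : K) (ψ : H) : ℝ := f z ψ + ‖z‖ ^ 2 * ‖ψ‖ ^ 2

theorem withFieldEnergy_of_norm_eq_one (f : K → H → ℝ) {ψ : H} (hψ : ‖ψ‖ = 1) (z : K) :
    withFieldEnergy f z ψ = f z ψ + ‖z‖ ^ 2 := by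
  rw [withFieldEnergy, hψ, one_pow, mul_one]

end FieldEnergy

section Pekar

variable {H : Type*} [NormedAddCommGroup H] [InnerProductSpace ℂ H]
variable {K : Type*} [NormedAddCommGroup K] [InnerProductSpace ℂ K]
variable {D : Submodule ℂ H} {f : K → H → ℝ} {E : H → K → EReal}

theorem IsQuadraticEnergy.isCriticalField_iff (hE : IsQuadraticEnergy D (withFieldEnergy f) E)
    {ψ : H} (hψ : ψ ∈ D) (hψ1 : ‖ψ‖ = 1) (z : K) :
    IsCriticalField E ψ z ↔ ∀ v : K, HasDerivAt
      (fun t : ℝ => f (z + (t : ℂ) • v) ψ + ‖z + (t : ℂ) • v‖ ^ 2) 0 0 := by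
  unfold IsCriticalField
  rw [and_iff_right ((hE.isFin_iff ψ z).2 hψ)]
  simp_rw [hE.eq_coe ψ hψ, EReal.toReal_coe, withFieldEnergy_of_norm_eq_one f hψ1]

variable [CompleteSpace K]

theorem IsQuadraticEnergy.exists_isCriticalField (hE : IsQuadraticEnergy D (withFieldEnergy f) E)
    (hf : ∀ ψ ∈ D, IsConvexQuadratic (fun z => f z ψ)) {ψ : H} (hψ : ψ ∈ D) (hψ1 : ‖ψ‖ = 1) :
    ∃ z, IsCriticalField E ψ z := by
  obtain ⟨z, hz⟩ := (hf ψ hψ).critical_add_norm_sq.1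
  exact ⟨z, (hE.isCriticalField_iff hψ hψ1 z).2 hz⟩

theorem IsQuadraticEnergy.le_of_isCriticalField (hE : IsQuadraticEnergy D (withFieldEnergy f) E)
    (hf : ∀ ψ ∈ D, IsConvexQuadratic (fun z => f z ψ)) {ψ : H} (hψ1 : ‖ψ‖ = 1) {z : K}
    (hz : IsCriticalField E ψ z) (y : K) : E ψ z ≤ E ψ y := by
  have hψ : ψ ∈ D := (hE.isFin_iff ψ z).1 hz.1
  have := (hf ψ hψ).critical_add_norm_sq.2 z ((hE.isCriticalField_iff hψ hψ1 z).1 hz) y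
  rw [hE.eq_coe ψ hψ, hE.eq_coe ψ hψ, withFieldEnergy_of_norm_eq_one f hψ1,
    withFieldEnergy_of_norm_eq_one f hψ1]
  exact EReal.coe_le_coe_iff.2 this

variable [CompleteSpace H] [TopologicalSpace.SeparableSpace H]
variable [MeasurableSpace K] [MeasurableSingletonClass K]

theorem tfae_exists_minimizer_pekarInf (hE : IsQuadraticEnergy D (withFieldEnergy f) E)
    (hf : ∀ ψ ∈ D, IsConvexQuadratic (fun z => f z ψ)) :
    [∃ p, IsQcMinimizer E p, ∃ ψ, IsPekarMinimizer (pekarInf E) ψ, ∃ m, IsSvmMinimizer E m,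
      ∃ p, IsPmMinimizer E p].TFAE := by
  -- The infimum over the field is attained at a critical point.
  have key : ∀ ψ ∈ D, ‖ψ‖ = 1 → ∃ z, pekarInf E ψ = E ψ z := by
    intro ψ hψ hψ1
    obtain ⟨z, hz⟩ := hE.exists_isCriticalField hf hψ hψ1
    exact ⟨z, le_antisymm (iInf_le _ z) (le_iInf (hE.le_of_isCriticalField hf hψ1 hz))⟩
  refine tfae_exists_minimizer hE (fun ψ hψ1 hfin => ?_) fun ψ z hψ1 hfin => ?_
  · refine key ψ ?_ hψ1
    by_contra hψ
    refine hfin.2 ?_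
    unfold pekarInf
    simp_rw [hE.eq_top ψ hψ, iInf_top]
  · have hψ := (hE.isFin_iff ψ z).1 hfin
    obtain ⟨y, hy⟩ := key ψ hψ hψ1
    exact ⟨hy ▸ (hE.isFin_iff ψ y).2 hψ, iInf_le _ z⟩

/-- Every critical point is a global minimizer, so the choice made in `pekarCritical` does not
affect its value. -/
theorem tfae_exists_minimizer_pekarCritical (hE : IsQuadraticEnergy D (withFieldEnergy f) E)
    (hf : ∀ ψ ∈ D, IsConvexQuadratic (fun z => f z ψ)) :
    [∃ p, IsQcMinimizer E p, ∃ ψ, IsPekarMinimizer (pekarCritical E) ψ, ∃ m, IsSvmMinimizer E m,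
      ∃ p, IsPmMinimizer E p].TFAE := by
  refine tfae_exists_minimizer hE (fun ψ hψ1 hfin => ?_) fun ψ z hψ1 hfin => ?_
  · unfold pekarCritical at hfin ⊢
    split_ifs at hfin ⊢ with h
    · exact ⟨_, rfl⟩
    · exact absurd rfl hfin.2
  · have hψ := (hE.isFin_iff ψ z).1 hfin
    have h := hE.exists_isCriticalField hf hψ hψ1
    unfold pekarCritical
    rw [dif_pos h]
    exact ⟨h.choose_spec.1, hE.le_of_isCriticalField hf hψ1 h.choose_spec z⟩

end Pekar

/-! ### Linear maps on a domain and bounded real linear maps -/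

section Linear

variable {H : Type*} [NormedAddCommGroup H] [InnerProductSpace ℂ H]

/-- `A` is linear on `D`. -/
structure IsLinearOn (D : Submodule ℂ H) (A : H → H) : Prop where
  add : ∀ ψ ∈ D, ∀ φ ∈ D, A (ψ + φ) = A ψ + A φ
  smul : ∀ (c : ℂ), ∀ ψ ∈ D, A (c • ψ) = c • A ψ

namespace IsLinearOn

variable {D : Submodule ℂ H} {A B : H → H}

theorem id (D : Submodule ℂ H) : IsLinearOn D (fun ψ => ψ) :=
  ⟨fun _ _ _ _ => rfl, fun _ _ _ => rfl⟩

theorem sub (hA : IsLinearOn D A) {ψ φ : H} (hψ : ψ ∈ D) (hφ : φ ∈ D) :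
    A (ψ - φ) = A ψ - A φ := by
  have h := hA.add ψ hψ _ (D.smul_mem (-1) hφ)
  rw [hA.smul _ φ hφ] at h
  simpa [sub_eq_add_neg] using h

theorem smul_add_smul (hA : IsLinearOn D A) (hB : IsLinearOn D B) (a b : ℂ) :
    IsLinearOn D (fun ψ => a • A ψ + b • B ψ) where
  add ψ hψ φ hφ := by
    rw [hA.add ψ hψ φ hφ, hB.add ψ hψ φ hφ, smul_add, smul_add]
    abel
  smul c ψ hψ := by
    rw [hA.smul c ψ hψ, hB.smul c ψ hψ, smul_add, smul_comm a, smul_comm b]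

theorem isQuadraticOn_re_inner (hA : IsLinearOn D A) (hB : IsLinearOn D B) :
    IsQuadraticOn D (fun ψ => (⟪A ψ, B ψ⟫_ℂ).re) where
  smul c ψ hψ := by
    rw [hA.smul c ψ hψ, hB.smul c ψ hψ, inner_smul_left, inner_smul_right, ← mul_assoc,
      ← Complex.normSq_eq_conj_mul_self, Complex.re_ofReal_mul, Complex.normSq_eq_norm_sq]
  parallelogram ψ hψ φ hφ := by
    rw [hA.add ψ hψ φ hφ, hB.add ψ hψ φ hφ, hA.sub hψ hφ, hB.sub hψ hφ]
    simp only [inner_add_left, inner_add_right, inner_sub_left, inner_sub_right, Complex.add_re,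
      Complex.sub_re]
    ring

theorem isQuadraticOn_norm_sq (hA : IsLinearOn D A) : IsQuadraticOn D (fun ψ => ‖A ψ‖ ^ 2) :=
  (hA.isQuadraticOn_re_inner hA).congr fun ψ _ => norm_sq_eq_re_inner (𝕜 := ℂ) (A ψ)

end IsLinearOn

variable {K : Type*} [NormedAddCommGroup K] [InnerProductSpace ℂ K]

/-- `S` is a bounded real linear map. -/
structure IsBoundedRealLinear (S : K → H) : Prop where
  add : ∀ z w, S (z + w) = S z + S w
  smul : ∀ (t : ℝ) z, S ((t : ℂ) • z) = (t : ℂ) • S z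
  bound : ∃ C, ∀ z, ‖S z‖ ≤ C * ‖z‖

namespace IsBoundedRealLinear

variable {S : K → H}

theorem exists_continuousLinearMap (hS : IsBoundedRealLinear S) :
    ∃ L : K →L[ℝ] H, ∀ z, L z = S z := by
  obtain ⟨C, hC⟩ := hS.bound
  exact ⟨LinearMap.mkContinuous
    { toFun := S
      map_add' := hS.add
      map_smul' := fun t z => by simpa using hS.smul t z } C hC, fun _ => rfl⟩

theorem isConvexQuadratic_re_inner (hS : IsBoundedRealLinear S) (a : ℝ) (u : H) :
    IsConvexQuadratic (fun z => a * (⟪u, S z⟫_ℂ).re) := by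
  obtain ⟨L, hL⟩ := hS.exists_continuousLinearMap
  have h := IsConvexQuadratic.re_inner ((a : ℂ) • u) L
  simpa [hL, inner_smul_left] using h

theorem isConvexQuadratic_norm_sq_add (hS : IsBoundedRealLinear S) (a : ℝ) (u : H) :
    IsConvexQuadratic (fun z => ‖u + (a : ℂ) • S z‖ ^ 2) := by
  obtain ⟨L, hL⟩ := hS.exists_continuousLinearMap
  have h := IsConvexQuadratic.norm_sq_add u (a • L)
  simpa [hL] using h

end IsBoundedRealLinear

end Linear

/-! ### Multiplication by a bounded function which depends linearly on the field -/

section Coupling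

variable {K : Type*} [NormedAddCommGroup K] [InnerProductSpace ℂ K]
variable {X : Type*} [MeasurableSpace X] {μ : Measure X}

/-- The functions `a z` are bounded by a multiple of `‖z‖` and depend linearly on `z`. -/
structure IsCoupling (μ : Measure X) (a : K → X → ℝ) : Prop where
  measurable : ∀ z, AEStronglyMeasurable (a z) μ
  bound : ∃ M, 0 ≤ M ∧ ∀ z, ∀ᵐ x ∂μ, |a z x| ≤ M * ‖z‖
  add : ∀ z w x, a (z + w) x = a z x + a w x
  smul : ∀ (t : ℝ) z x, a ((t : ℂ) • z) x = t * a z x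

namespace IsCoupling

variable {a : K → X → ℝ}

theorem comp {Y : Type*} [MeasurableSpace Y] {ν : Measure Y} {f : Y → X} (ha : IsCoupling μ a)
    (hf : Measure.QuasiMeasurePreserving f ν μ) : IsCoupling ν (fun z y => a z (f y)) where
  measurable z := (ha.measurable z).comp_quasiMeasurePreserving hf
  bound := by
    obtain ⟨M, hM, h⟩ := ha.bound
    exact ⟨M, hM, fun z => hf.ae (h z)⟩
  add z w y := ha.add z w (f y)
  smul t z y := ha.smul t z (f y)

/-- The bound is Cauchy-Schwarz, and weak measurability of `g` suffices. This serves both the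
pairing, with `g = ω^{-1/2} lam`, and the Fourier integrals of the polaron. -/
theorem of_inner {𝔥 : Type*} [NormedAddCommGroup 𝔥] [InnerProductSpace ℂ 𝔥] {S : K → 𝔥}
    (hS : IsBoundedRealLinear S) {g : X → 𝔥} {C : ℝ} (hC : 0 ≤ C) (hg : ∀ᵐ x ∂μ, ‖g x‖ ≤ C)
    (hm : ∀ u : 𝔥, AEStronglyMeasurable (fun x => ⟪u, g x⟫_ℂ) μ) :
    IsCoupling μ (fun z x => 2 * (⟪S z, g x⟫_ℂ).re) where
  measurable z := (Complex.continuous_re.comp_aestronglyMeasurable (hm (S z))).const_mul 2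
  bound := by
    obtain ⟨B, hB⟩ := hS.bound
    refine ⟨2 * (|B| * C), by positivity, fun z => hg.mono fun x hx => ?_⟩
    have h1 : ‖S z‖ ≤ |B| * ‖z‖ :=
      (hB z).trans (mul_le_mul_of_nonneg_right (le_abs_self B) (norm_nonneg z))
    calc |2 * (⟪S z, g x⟫_ℂ).re| = 2 * |(⟪S z, g x⟫_ℂ).re| := by rw [abs_mul]; norm_num
      _ ≤ 2 * (‖S z‖ * ‖g x‖) := by
          gcongr
          exact (Complex.abs_re_le_norm _).trans (norm_inner_le_norm _ _)
      _ ≤ 2 * (|B| * ‖z‖ * C) := by gcongr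
      _ = 2 * (|B| * C) * ‖z‖ := by ring
  add z w x := by rw [hS.add, inner_add_left, Complex.add_re]; ring
  smul t z x := by
    rw [hS.smul, inner_smul_left, Complex.conj_ofReal, Complex.re_ofReal_mul]; ring

theorem memLp_mul (ha : IsCoupling μ a) (z : K) (ψ : Lp ℂ 2 μ) :
    MemLp (fun x => (a z x : ℂ) * ψ x) 2 μ := by
  obtain ⟨M, -, h⟩ := ha.bound
  refine (Lp.memLp ψ).of_le_mul (c := M * ‖z‖) ?_ ((h z).mono fun x hx => ?_)
  · exact (Complex.continuous_ofReal.comp_aestronglyMeasurable (ha.measurable z)).mul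
      (Lp.aestronglyMeasurable ψ)
  · rw [norm_mul, Complex.norm_real, Real.norm_eq_abs]
    gcongr

/-- The wave function `a_z ψ`. -/
def mulWave (ha : IsCoupling μ a) (z : K) (ψ : Lp ℂ 2 μ) : Lp ℂ 2 μ := (ha.memLp_mul z ψ).toLp

theorem coeFn_mulWave (ha : IsCoupling μ a) (z : K) (ψ : Lp ℂ 2 μ) :
    ha.mulWave z ψ =ᵐ[μ] fun x => (a z x : ℂ) * ψ x := (ha.memLp_mul z ψ).coeFn_toLp

theorem isLinearOn_mulWave (ha : IsCoupling μ a) (D : Submodule ℂ (Lp ℂ 2 μ)) (z : K) :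
    IsLinearOn D (ha.mulWave z) where
  add ψ _ φ _ := by
    refine Lp.ext ?_
    filter_upwards [ha.coeFn_mulWave z (ψ + φ), ha.coeFn_mulWave z ψ, ha.coeFn_mulWave z φ,
      Lp.coeFn_add ψ φ, Lp.coeFn_add (ha.mulWave z ψ) (ha.mulWave z φ)] with x h1 h2 h3 h4 h5
    rw [h1, h5, Pi.add_apply, h2, h3, h4, Pi.add_apply]
    ring
  smul c ψ _ := by
    refine Lp.ext ?_
    filter_upwards [ha.coeFn_mulWave z (c • ψ), ha.coeFn_mulWave z ψ, Lp.coeFn_smul c ψ,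
      Lp.coeFn_smul c (ha.mulWave z ψ)] with x h1 h2 h3 h4
    rw [h1, h4, Pi.smul_apply, h2, h3, Pi.smul_apply, smul_eq_mul, smul_eq_mul]
    ring

theorem isBoundedRealLinear_mulWave (ha : IsCoupling μ a) (ψ : Lp ℂ 2 μ) :
    IsBoundedRealLinear (fun z => ha.mulWave z ψ) where
  add z w := by
    refine Lp.ext ?_
    filter_upwards [ha.coeFn_mulWave (z + w) ψ, ha.coeFn_mulWave z ψ, ha.coeFn_mulWave w ψ,
      Lp.coeFn_add (ha.mulWave z ψ) (ha.mulWave w ψ)] with x h1 h2 h3 h4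
    rw [h1, h4, Pi.add_apply, h2, h3, ha.add]
    push_cast
    ring
  smul t z := by
    refine Lp.ext ?_
    filter_upwards [ha.coeFn_mulWave ((t : ℂ) • z) ψ, ha.coeFn_mulWave z ψ,
      Lp.coeFn_smul (t : ℂ) (ha.mulWave z ψ)] with x h1 h2 h3
    rw [h1, h3, Pi.smul_apply, h2, ha.smul, smul_eq_mul]
    push_cast
    ring
  bound := by
    obtain ⟨M, -, h⟩ := ha.bound
    refine ⟨M * ‖ψ‖, fun z => ?_⟩
    have h1 : ‖ha.mulWave z ψ‖ ≤ M * ‖z‖ * ‖ψ‖ := by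
      refine Lp.norm_le_mul_norm_of_ae_le_mul ?_
      filter_upwards [ha.coeFn_mulWave z ψ, h z] with x h2 h3
      rw [h2, norm_mul, Complex.norm_real, Real.norm_eq_abs]
      gcongr
    linarith [h1, mul_right_comm M ‖z‖ ‖ψ‖]

/-- This and the next two formulas express interaction integrals through `mulWave`, which is linear
in `ψ` for fixed `z` and real linear in `z` for fixed `ψ`. -/
theorem integral_mul_norm_sq (ha : IsCoupling μ a) (z : K) (ψ : Lp ℂ 2 μ) :
    ∫ x, a z x * ‖ψ x‖ ^ 2 ∂μ = (⟪ψ, ha.mulWave z ψ⟫_ℂ).re := by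
  rw [L2.inner_def, ← RCLike.re_eq_complex_re, ← integral_re (L2.integrable_inner _ _)]
  refine integral_congr_ae ?_
  filter_upwards [ha.coeFn_mulWave z ψ] with x hx
  rw [hx, RCLike.inner_apply, mul_assoc, Complex.mul_conj, RCLike.re_eq_complex_re,
    Complex.re_ofReal_mul, Complex.ofReal_re, Complex.normSq_eq_norm_sq]

theorem integral_conj_mul_mul (ha : IsCoupling μ a) (z : K) (ψ g : Lp ℂ 2 μ) :
    ∫ x, (starRingEnd ℂ) (ψ x) * (a z x : ℂ) * g x ∂μ = ⟪ha.mulWave z ψ, g⟫_ℂ := by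
  rw [L2.inner_def]
  refine integral_congr_ae ?_
  filter_upwards [ha.coeFn_mulWave z ψ] with x hx
  rw [hx, RCLike.inner_apply, map_mul, Complex.conj_ofReal]
  ring

theorem integral_norm_sq_add (ha : IsCoupling μ a) (z : K) (b c : ℂ) (ψ g : Lp ℂ 2 μ) :
    ∫ x, ‖b * g x + c * ((a z x : ℂ) * ψ x)‖ ^ 2 ∂μ = ‖b • g + c • ha.mulWave z ψ‖ ^ 2 := by
  rw [@norm_sq_eq_re_inner ℂ, L2.inner_def, ← integral_re (L2.integrable_inner _ _)]
  refine integral_congr_ae ?_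
  filter_upwards [ha.coeFn_mulWave z ψ, Lp.coeFn_add (b • g) (c • ha.mulWave z ψ),
    Lp.coeFn_smul b g, Lp.coeFn_smul c (ha.mulWave z ψ)] with x h1 h2 h3 h4
  rw [← norm_sq_eq_re_inner, h2, Pi.add_apply, h3, h4, Pi.smul_apply, Pi.smul_apply, h1,
    smul_eq_mul, smul_eq_mul]

end IsCoupling

end Coupling

/-! ### The form domain -/

section FormDomain

variable {d N : ℕ}

theorem locallyIntegrable_wave (ψ : Wave d N) : LocallyIntegrable ψ :=
  (Lp.memLp ψ).locallyIntegrable one_le_two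

theorem integrable_test_smul {φ : Config d N → ℝ} (hφ : Continuous φ) (hs : HasCompactSupport φ)
    (ψ : Wave d N) : Integrable (fun X => φ X • ψ X) :=
  (locallyIntegrable_wave ψ).integrable_smul_left_of_hasCompactSupport hφ hs

theorem integrable_fderiv_test_smul {φ : Config d N → ℝ}
    (hφ : ContDiff ℝ ((⊤ : ℕ∞) : WithTop ℕ∞) φ) (hs : HasCompactSupport φ) (v : Config d N)
    (ψ : Wave d N) : Integrable (fun X => (fderiv ℝ φ X v) • ψ X) :=
  integrable_test_smul ((hφ.continuous_fderiv (by simp)).clm_apply continuous_const)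
    (hs.fderiv_apply ℝ v) ψ

namespace IsWeakPartial

variable {i : Fin N × Fin d} {ψ φ g h : Wave d N}

/-- Test functions separate locally integrable functions. Uniqueness is what makes the chosen
`weakPartial` linear. -/
theorem unique (hg : IsWeakPartial i ψ g) (hh : IsWeakPartial i ψ h) : g = h := by
  refine Lp.ext ?_
  refine ae_eq_of_integral_contDiff_smul_eq (locallyIntegrable_wave g) (locallyIntegrable_wave h)
    fun χ hχ hs => ?_
  exact neg_injective ((hg χ hχ hs).symm.trans (hh χ hχ hs))

theorem add (hg : IsWeakPartial i ψ g) (hh : IsWeakPartial i φ h) :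
    IsWeakPartial i (ψ + φ) (g + h) := by
  intro χ hχ hs
  have h1 : ∫ X, (fderiv ℝ χ X (EuclideanSpace.single i 1)) • (ψ + φ : Wave d N) X
      = ∫ X, ((fderiv ℝ χ X (EuclideanSpace.single i 1)) • ψ X
        + (fderiv ℝ χ X (EuclideanSpace.single i 1)) • φ X) := by
    refine integral_congr_ae ((Lp.coeFn_add ψ φ).mono fun X hX => ?_)
    simp only [hX, Pi.add_apply, smul_add]
  have h2 : ∫ X, χ X • (g + h : Wave d N) X = ∫ X, (χ X • g X + χ X • h X) := by
    refine integral_congr_ae ((Lp.coeFn_add g h).mono fun X hX => ?_)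
    simp only [hX, Pi.add_apply, smul_add]
  rw [h1, h2, integral_add (integrable_fderiv_test_smul hχ hs _ ψ)
    (integrable_fderiv_test_smul hχ hs _ φ), integral_add (integrable_test_smul hχ.continuous hs g)
    (integrable_test_smul hχ.continuous hs h), hg χ hχ hs, hh χ hχ hs, neg_add]

theorem smul (c : ℂ) (hg : IsWeakPartial i ψ g) : IsWeakPartial i (c • ψ) (c • g) := by
  intro χ hχ hs
  have h1 : ∫ X, (fderiv ℝ χ X (EuclideanSpace.single i 1)) • (c • ψ : Wave d N) X
      = ∫ X, c • ((fderiv ℝ χ X (EuclideanSpace.single i 1)) • ψ X) := by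
    refine integral_congr_ae ((Lp.coeFn_smul c ψ).mono fun X hX => ?_)
    simp only [hX, Pi.smul_apply]
    rw [smul_comm]
  have h2 : ∫ X, χ X • (c • g : Wave d N) X = ∫ X, c • (χ X • g X) := by
    refine integral_congr_ae ((Lp.coeFn_smul c g).mono fun X hX => ?_)
    simp only [hX, Pi.smul_apply]
    rw [smul_comm]
  rw [h1, h2, integral_smul, integral_smul, hg χ hχ hs, smul_neg]

theorem weakPartial_eq (hg : IsWeakPartial i ψ g) : weakPartial i ψ = g := by
  have h : ∃ g, IsWeakPartial i ψ g := ⟨g, hg⟩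
  unfold weakPartial
  rw [dif_pos h]
  exact h.choose_spec.unique hg

end IsWeakPartial

theorem InH1.isWeakPartial {ψ : Wave d N} (h : InH1 ψ) (i : Fin N × Fin d) :
    IsWeakPartial i ψ (weakPartial i ψ) := by
  obtain ⟨g, hg⟩ := h i
  rwa [hg.weakPartial_eq]

theorem integrable_potential_add {W : Config d N → ℝ} (hW : IsPotential W) {ψ φ : Wave d N}
    (hψ : Integrable (fun X => W X * ‖ψ X‖ ^ 2)) (hφ : Integrable (fun X => W X * ‖φ X‖ ^ 2)) :
    Integrable (fun X => W X * ‖(ψ + φ : Wave d N) X‖ ^ 2) := by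
  refine ((hψ.add hφ).const_mul 2).mono' ?_ ?_
  · exact hW.1.aestronglyMeasurable.mul ((Lp.aestronglyMeasurable _).norm.pow 2)
  · filter_upwards [hW.2, Lp.coeFn_add ψ φ] with X h0 hX
    rw [hX, Pi.add_apply, Pi.add_apply, Real.norm_eq_abs, abs_of_nonneg (by positivity)]
    have h1 := norm_add_le (ψ X) (φ X)
    have h2 : ‖ψ X + φ X‖ ^ 2 ≤ 2 * (‖ψ X‖ ^ 2 + ‖φ X‖ ^ 2) := by
      nlinarith [norm_nonneg (ψ X + φ X), sq_nonneg (‖ψ X‖ - ‖φ X‖)]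
    nlinarith [mul_le_mul_of_nonneg_left h2 h0]

theorem integrable_potential_smul {W : Config d N → ℝ} (c : ℂ) {ψ : Wave d N}
    (hψ : Integrable (fun X => W X * ‖ψ X‖ ^ 2)) :
    Integrable (fun X => W X * ‖(c • ψ : Wave d N) X‖ ^ 2) := by
  refine (hψ.const_mul (‖c‖ ^ 2)).congr ?_
  filter_upwards [Lp.coeFn_smul c ψ] with X hX
  rw [hX, Pi.smul_apply, norm_smul]
  ring

/-- The form domain of `-Δ + W` as a linear space. -/
def formDomain (W : Config d N → ℝ) (hW : IsPotential W) : Submodule ℂ (Wave d N) where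
  carrier := {ψ | FormDomain W ψ}
  zero_mem' := by
    refine ⟨fun i => ⟨0, fun χ _ _ => ?_⟩, (integrable_zero _ ℝ volume).congr ?_⟩
    · have h1 : ∀ f : Config d N → ℝ, ∫ X, f X • (0 : Wave d N) X = 0 := fun f =>
        integral_eq_zero_of_ae (Eventually.of_forall fun X => by simp)
      rw [h1, h1, neg_zero]
    · exact Eventually.of_forall fun X => by simp
  add_mem' hψ hφ := ⟨fun i => ⟨_, (hψ.1.isWeakPartial i).add (hφ.1.isWeakPartial i)⟩,
    integrable_potential_add hW hψ.2 hφ.2⟩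
  smul_mem' c _ hψ := ⟨fun i => ⟨_, (hψ.1.isWeakPartial i).smul c⟩,
    integrable_potential_smul c hψ.2⟩

variable {W : Config d N → ℝ} (hW : IsPotential W)

theorem isLinearOn_weakPartial (i : Fin N × Fin d) :
    IsLinearOn (formDomain W hW) (weakPartial i) where
  add _ hψ _ hφ := ((hψ.1.isWeakPartial i).add (hφ.1.isWeakPartial i)).weakPartial_eq
  smul c _ hψ := ((hψ.1.isWeakPartial i).smul c).weakPartial_eq

theorem isQuadraticOn_potential :
    IsQuadraticOn (formDomain W hW) (fun ψ => ∫ X, W X * ‖ψ X‖ ^ 2) where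
  smul c ψ _ := by
    rw [← integral_const_mul]
    refine integral_congr_ae ((Lp.coeFn_smul c ψ).mono fun X hX => ?_)
    simp only [hX, Pi.smul_apply, norm_smul]
    ring
  parallelogram ψ hψ φ hφ := by
    rw [← integral_add ((formDomain W hW).add_mem hψ hφ).2 ((formDomain W hW).sub_mem hψ hφ).2,
      ← integral_const_mul, ← integral_const_mul,
      ← integral_add (hψ.2.const_mul 2) (hφ.2.const_mul 2)]
    refine integral_congr_ae ?_
    filter_upwards [Lp.coeFn_add ψ φ, Lp.coeFn_sub ψ φ] with X h1 h2
    rw [h1, h2, Pi.add_apply, Pi.sub_apply]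
    have := parallelogram_law_with_norm ℂ (ψ X) (φ X)
    linear_combination W X * this

theorem isQuadraticOn_freeForm : IsQuadraticOn (formDomain W hW) (freeForm W) :=
  (IsQuadraticOn.sum _ fun i _ => (isLinearOn_weakPartial hW i).isQuadraticOn_norm_sq).add
    (isQuadraticOn_potential hW)

/-- A surjective linear map sends Lebesgue measure to a multiple, possibly infinite, of Lebesgue
measure. So null sets pull back to null sets, and one-particle bounds hold on configurations. -/
theorem quasiMeasurePreserving_pos (j : Fin N) :
    Measure.QuasiMeasurePreserving (pos (d := d) j) volume volume := by
  let L : Config d N →ₗ[ℝ] EuclideanSpace ℝ (Fin d) :=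
    { toFun := pos j
      map_add' := fun _ _ => rfl
      map_smul' := fun _ _ => rfl }
  have hL : Function.Surjective L := fun x =>
    ⟨WithLp.toLp 2 (fun p => x p.2), rfl⟩
  obtain ⟨c, -, hc⟩ := L.exists_map_addHaar_eq_smul_addHaar volume volume hL
  refine ⟨L.continuous_of_finiteDimensional.measurable, ?_⟩
  change Measure.map L volume ≪ volume
  rw [hc]
  exact Measure.smul_absolutelyContinuous

end FormDomain

/-! ### The field operators -/

section SqrtExt

variable {𝔥 : Type*} [NormedAddCommGroup 𝔥] [InnerProductSpace ℂ 𝔥]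

theorem applyOp_of_mem {T : 𝔥 →ₗ.[ℂ] 𝔥} {v : 𝔥} (h : v ∈ T.domain) : applyOp T v = T ⟨v, h⟩ :=
  dif_pos h

variable [CompleteSpace 𝔥]

theorem inner_apply_comm_of_isSelfAdjoint {T : 𝔥 →ₗ.[ℂ] 𝔥} (hT : IsSelfAdjoint T)
    (x y : T.domain) : ⟪T x, (y : 𝔥)⟫_ℂ = ⟪(x : 𝔥), T y⟫_ℂ := by
  have h := LinearPMap.adjoint_isFormalAdjoint (T := T) hT.dense_domain
  rw [LinearPMap.isSelfAdjoint_def.1 hT] at h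
  exact h x y

variable {ω : Dispersion 𝔥} {σ : 𝔥 →ₗ.[ℂ] 𝔥}

/-- The equality of graphs in `IsPositiveSqrt.sq`, unpacked into domains and values. -/
theorem IsPositiveSqrt.exists_apply (hσ : IsPositiveSqrt σ ω.op) (x : ω.op.domain) :
    ∃ hx : (x : 𝔥) ∈ σ.domain, ∃ hu : σ ⟨x, hx⟩ ∈ σ.domain, σ ⟨_, hu⟩ = ω.op x := by
  obtain ⟨u, hxu, huy⟩ := (hσ.sq x (ω.op x)).1 (ω.op.mem_graph x)
  obtain ⟨x', hx', rfl⟩ := (LinearPMap.mem_graph_iff σ).1 hxu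
  obtain ⟨u', hu', hy⟩ := (LinearPMap.mem_graph_iff σ).1 huy
  simp only at hx' hu' hy
  have hx : (x : 𝔥) ∈ σ.domain := hx' ▸ x'.2
  have hxe : (⟨x, hx⟩ : σ.domain) = x' := Subtype.ext hx'.symm
  have hu : σ ⟨x, hx⟩ ∈ σ.domain := by
    rw [hxe, ← hu']
    exact u'.2
  refine ⟨hx, hu, ?_⟩
  rw [← hy]
  congr 1
  exact Subtype.ext ((congrArg σ hxe).trans hu'.symm)

/-- The square root of `ω` is isometric for the scalar product `⟨x, ω y⟩`. -/
def sqrtIsometry (hσ : IsPositiveSqrt σ ω.op) : ω.SmoothVec →ₗᵢ[ℂ] 𝔥 where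
  toFun x := applyOp σ (ω.toDomain x : 𝔥)
  map_add' x y := by
    obtain ⟨hx, -⟩ := hσ.exists_apply (ω.toDomain x)
    obtain ⟨hy, -⟩ := hσ.exists_apply (ω.toDomain y)
    obtain ⟨hxy, -⟩ := hσ.exists_apply (ω.toDomain (x + y))
    rw [applyOp_of_mem hx, applyOp_of_mem hy, applyOp_of_mem hxy, ← σ.map_add]
    congr 1
  map_smul' c x := by
    obtain ⟨hx, -⟩ := hσ.exists_apply (ω.toDomain x)
    obtain ⟨hcx, -⟩ := hσ.exists_apply (ω.toDomain (c • x))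
    rw [applyOp_of_mem hx, applyOp_of_mem hcx, RingHom.id_apply, ← σ.map_smul]
    congr 1
  norm_map' x := by
    obtain ⟨hx, hu, hy⟩ := hσ.exists_apply (ω.toDomain x)
    change ‖applyOp σ (ω.toDomain x : 𝔥)‖ = ‖x‖
    have h1 : ‖x‖ ^ 2 = RCLike.re ⟪(ω.toDomain x : 𝔥), ω.op (ω.toDomain x)⟫_ℂ :=
      norm_sq_eq_re_inner (𝕜 := ℂ) x
    have h2 : ‖applyOp σ (ω.toDomain x : 𝔥)‖ ^ 2 = ‖x‖ ^ 2 := by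
      rw [h1, applyOp_of_mem hx, @norm_sq_eq_re_inner ℂ, ← hy,
        ← inner_apply_comm_of_isSelfAdjoint hσ.selfAdjoint ⟨_, hx⟩ ⟨_, hu⟩]
    exact (pow_left_inj₀ (norm_nonneg _) (norm_nonneg _) two_ne_zero).1 h2

/-- The identities hold on the dense image of `ω.SmoothVec`, where `σ` is a linear isometry, and are
closed conditions. -/
theorem isBoundedRealLinear_sqrtExt (hσ : IsPositiveSqrt σ ω.op) :
    IsBoundedRealLinear (ω.sqrtExt σ) := by
  have huc : UniformContinuous (fun x : ω.SmoothVec => applyOp σ (ω.toDomain x : 𝔥)) :=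
    (sqrtIsometry hσ).isometry.uniformContinuous
  have hcoe : ∀ x : ω.SmoothVec, ω.sqrtExt σ x = sqrtIsometry hσ x := fun x =>
    UniformSpace.Completion.extension_coe huc x
  have hc : Continuous (ω.sqrtExt σ) := UniformSpace.Completion.continuous_extension
  refine ⟨fun z w => ?_, fun t z => ?_, 1, fun z => ?_⟩
  · refine UniformSpace.Completion.induction_on₂ z w
      (isClosed_eq (hc.comp continuous_add)
        ((hc.comp continuous_fst).add (hc.comp continuous_snd))) fun x y => ?_
    rw [← UniformSpace.Completion.coe_add, hcoe, hcoe, hcoe, map_add]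
  · refine UniformSpace.Completion.induction_on z
      (isClosed_eq (hc.comp (continuous_const_smul (t : ℂ))) (hc.const_smul (t : ℂ))) fun x => ?_
    rw [← UniformSpace.Completion.coe_smul, hcoe, hcoe, map_smul]
  · refine UniformSpace.Completion.induction_on z
      (isClosed_le hc.norm (continuous_const.mul continuous_norm)) fun x => ?_
    rw [hcoe, LinearIsometry.norm_map, UniformSpace.Completion.norm_coe, one_mul]

theorem isCoupling_pairing {d : ℕ} (hσ : IsPositiveSqrt σ ω.op)
    {lam : EuclideanSpace ℝ (Fin d) → 𝔥} (hlam : IsFormFactor σ lam) :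
    IsCoupling volume (fun (z : ω.FieldSpace) x => 2 * (ω.pairing σ z (lam x)).re) := by
  refine IsCoupling.of_inner (isBoundedRealLinear_sqrtExt hσ)
    (C := (eLpNormEssSup (fun x => applyOp σ.inverse (lam x)) volume).toReal)
    ENNReal.toReal_nonneg ?_ fun u => hlam.memLp_inv.1.const_inner
  have hfin : eLpNormEssSup (fun x => applyOp σ.inverse (lam x)) volume ≠ ∞ := by
    have := hlam.memLp_inv.2
    rw [eLpNorm_exponent_top] at this
    exact this.ne
  filter_upwards [ae_le_eLpNormEssSup (f := fun x => applyOp σ.inverse (lam x)) (μ := volume)]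
    with x hx
  have := ENNReal.toReal_mono hfin hx
  rwa [toReal_enorm] at this

end SqrtExt

/-! ### Boundedness of the polaron potentials -/

section Polaron

variable {d : ℕ}

/-- In polar coordinates the square `|k|^{-(d-1)}` cancels the Jacobian exactly, leaving the
constant `1` on `(0, r]`. -/
theorem memLp_two_restrict_norm_rpow_low (hd : 1 ≤ d) (r : ℝ) :
    MemLp (fun k : EuclideanSpace ℝ (Fin d) => ((‖k‖ ^ (-(((d : ℝ) - 1) / 2)) : ℝ) : ℂ)) 2
      (volume.restrict {k | ‖k‖ ≤ r}) := by
  have hmeas : MeasurableSet {k : EuclideanSpace ℝ (Fin d) | ‖k‖ ≤ r} :=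
    measurableSet_le measurable_norm measurable_const
  have : Nonempty (Fin d) := ⟨⟨0, hd⟩⟩
  have hm : Measurable fun k : EuclideanSpace ℝ (Fin d) =>
      ((‖k‖ ^ (-(((d : ℝ) - 1) / 2)) : ℝ) : ℂ) :=
    Complex.measurable_ofReal.comp (measurable_norm.pow_const _)
  rw [memLp_two_iff_integrable_sq_norm hm.aestronglyMeasurable]
  change IntegrableOn _ _ _
  rw [← integrable_indicator_iff hmeas]
  have h := (integrable_fun_norm_addHaar (volume : Measure (EuclideanSpace ℝ (Fin d)))
    (f := (Iic r).indicator fun y => (y ^ (-(((d : ℝ) - 1) / 2))) ^ 2)).2 ?_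
  · refine h.congr (Eventually.of_forall fun k => ?_)
    by_cases hk : ‖k‖ ≤ r
    · simp [hk, Complex.norm_real, Real.norm_eq_abs]
    · simp [hk]
  · have h1 : IntegrableOn (fun _ : ℝ => (1 : ℝ)) (Ioc 0 r) := by simp
    have h2 : IntegrableOn ((Iic r).indicator fun _ : ℝ => (1 : ℝ)) (Ioi 0) := by
      rw [integrableOn_indicator_iff measurableSet_Iic]
      exact h1.mono_set fun x hx => ⟨by simpa using hx.2, by simpa using hx.1⟩
    refine h2.congr_fun (fun y hy => ?_) measurableSet_Ioi
    have hy0 : (0 : ℝ) < y := hy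
    by_cases hyr : y ≤ r
    · simp only [mem_Iic, hyr, indicator_of_mem, smul_eq_mul, finrank_euclideanSpace,
        Fintype.card_fin]
      rw [← Real.rpow_natCast, ← Real.rpow_natCast, ← Real.rpow_mul hy0.le, ← Real.rpow_add hy0,
        Nat.cast_sub hd]
      push_cast
      rw [show (d : ℝ) - 1 + -(((d : ℝ) - 1) / 2) * 2 = 0 by ring, Real.rpow_zero]
    · simp [hyr]

/-- Two more powers of decay leave `y^{-2}` after the Jacobian, integrable at infinity; the cut-off
`r > 0` removes the origin. -/
theorem memLp_two_restrict_norm_rpow_high (hd : 1 ≤ d) {r : ℝ} (hr : 0 < r) :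
    MemLp (fun k : EuclideanSpace ℝ (Fin d) => ((‖k‖ ^ (-(((d : ℝ) + 1) / 2)) : ℝ) : ℂ)) 2
      (volume.restrict {k | r < ‖k‖}) := by
  have hmeas : MeasurableSet {k : EuclideanSpace ℝ (Fin d) | r < ‖k‖} :=
    measurableSet_lt measurable_const measurable_norm
  have : Nonempty (Fin d) := ⟨⟨0, hd⟩⟩
  have hm : Measurable fun k : EuclideanSpace ℝ (Fin d) =>
      ((‖k‖ ^ (-(((d : ℝ) + 1) / 2)) : ℝ) : ℂ) :=
    Complex.measurable_ofReal.comp (measurable_norm.pow_const _)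
  rw [memLp_two_iff_integrable_sq_norm hm.aestronglyMeasurable]
  change IntegrableOn _ _ _
  rw [← integrable_indicator_iff hmeas]
  have h := (integrable_fun_norm_addHaar (volume : Measure (EuclideanSpace ℝ (Fin d)))
    (f := (Ioi r).indicator fun y => (y ^ (-(((d : ℝ) + 1) / 2))) ^ 2)).2 ?_
  · refine h.congr (Eventually.of_forall fun k => ?_)
    by_cases hk : r < ‖k‖
    · simp [hk, Complex.norm_real, Real.norm_eq_abs]
    · simp [hk]
  · have h1 : IntegrableOn (fun y : ℝ => y ^ (-2 : ℝ)) (Ioi r) :=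
      integrableOn_Ioi_rpow_of_lt (by norm_num) hr
    have h2 : IntegrableOn ((Ioi r).indicator fun y : ℝ => y ^ (-2 : ℝ)) (Ioi 0) := by
      rw [integrableOn_indicator_iff measurableSet_Ioi]
      exact h1.mono_set inter_subset_left
    refine h2.congr_fun (fun y hy => ?_) measurableSet_Ioi
    have hy0 : (0 : ℝ) < y := hy
    by_cases hyr : r < y
    · simp only [mem_Ioi, hyr, indicator_of_mem, smul_eq_mul, finrank_euclideanSpace,
        Fintype.card_fin]
      rw [← Real.rpow_natCast, ← Real.rpow_natCast, ← Real.rpow_mul hy0.le, ← Real.rpow_add hy0,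
        Nat.cast_sub hd]
      push_cast
      rw [show (d : ℝ) - 1 + -(((d : ℝ) + 1) / 2) * 2 = -2 by ring]
    · simp [hyr]

theorem norm_exp_neg_I_mul (t : ℝ) : ‖Complex.exp (-Complex.I * (t : ℂ))‖ = 1 := by
  rw [show -Complex.I * (t : ℂ) = ((-t : ℝ) : ℂ) * Complex.I by push_cast; ring]
  exact Complex.norm_exp_ofReal_mul_I _

/-- The functions `x ↦ 2 Re ∫_S conj z(k) h(k) e^{-ik·x} dk` with `h ∈ L²(S)` are bounded and depend
linearly on `z`. -/
theorem isCoupling_fourier {S : Set (EuclideanSpace ℝ (Fin d))} (hS : MeasurableSet S)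
    {h : EuclideanSpace ℝ (Fin d) → ℂ} (hh : MemLp h 2 (volume.restrict S)) :
    IsCoupling volume (fun (z : PolaronField d) x => 2 * (∫ k in S, (starRingEnd ℂ) (z k) *
      (h k * Complex.exp (-Complex.I * ((⟪k, x⟫_ℝ : ℝ) : ℂ)))).re) := by
  have hexp : ∀ x : EuclideanSpace ℝ (Fin d), Continuous fun k : EuclideanSpace ℝ (Fin d) =>
      Complex.exp (-Complex.I * ((⟪k, x⟫_ℝ : ℝ) : ℂ)) := fun x => by fun_prop
  have hnorm : ∀ k x : EuclideanSpace ℝ (Fin d),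
      ‖h k * Complex.exp (-Complex.I * ((⟪k, x⟫_ℝ : ℝ) : ℂ))‖ = ‖h k‖ := fun k x => by
    rw [norm_mul, norm_exp_neg_I_mul, mul_one]
  have hmem0 : ∀ x, MemLp (fun k => h k * Complex.exp (-Complex.I * ((⟪k, x⟫_ℝ : ℝ) : ℂ))) 2
      (volume.restrict S) := fun x =>
    hh.of_le (hh.1.mul (hexp x).aestronglyMeasurable) (Eventually.of_forall fun k => (hnorm k x).le)
  have hmem : ∀ x, MemLp (S.indicator fun k => h k *
      Complex.exp (-Complex.I * ((⟪k, x⟫_ℝ : ℝ) : ℂ))) 2 volume := fun x =>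
    (memLp_indicator_iff_restrict hS).2 (hmem0 x)
  have hind : MemLp (S.indicator h) 2 volume := (memLp_indicator_iff_restrict hS).2 hh
  -- The integral is a scalar product with `h e^{-ik·x}` extended by zero outside `S`, whose norm is
  -- independent of `x`.
  have hinner : ∀ (z : PolaronField d) x, ⟪z, (hmem x).toLp⟫_ℂ = ∫ k in S, (starRingEnd ℂ) (z k) *
      (h k * Complex.exp (-Complex.I * ((⟪k, x⟫_ℝ : ℝ) : ℂ))) := by
    intro z x
    rw [L2.inner_def, ← integral_indicator hS]
    refine integral_congr_ae ?_
    filter_upwards [(hmem x).coeFn_toLp] with k hk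
    rw [hk, RCLike.inner_apply]
    by_cases hkS : k ∈ S
    · simp [hkS, mul_comm]
    · simp [hkS]
  have hid : IsBoundedRealLinear (fun z : PolaronField d => z) :=
    ⟨fun _ _ => rfl, fun _ _ => rfl, 1, fun z => by simp⟩
  simp_rw [← hinner]
  refine IsCoupling.of_inner hid (C := ‖hind.toLp‖) (norm_nonneg _)
    (Eventually.of_forall fun x => ?_) fun z => ?_
  · refine Lp.norm_le_norm_of_ae_le ?_
    filter_upwards [(hmem x).coeFn_toLp, hind.coeFn_toLp] with k h1 h2
    rw [h1, h2]
    by_cases hkS : k ∈ S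
    · simp only [hkS, indicator_of_mem]
      exact (hnorm k x).le
    · simp [hkS]
  · simp_rw [hinner]
    have hz : MemLp (fun k => (starRingEnd ℂ) (z k)) 2 (volume.restrict S) :=
      ((Lp.memLp z).star).restrict S
    -- Measurability in `x` comes from continuity, by domination with `|z| |h|`, a product of two
    -- `L²` functions.
    refine Continuous.aestronglyMeasurable (continuous_of_dominated
      (bound := fun k => ‖(starRingEnd ℂ) (z k)‖ * ‖h k‖) (fun x => ?_) (fun x => ?_) ?_ ?_)
    · exact hz.1.mul (hmem0 x).1
    · exact Eventually.of_forall fun k => by rw [norm_mul, hnorm]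
    · exact hz.norm.integrable_mul hh.norm
    · exact Eventually.of_forall fun k => by fun_prop

theorem isCoupling_polaronLow (hd : 1 ≤ d) (r : ℝ) :
    IsCoupling volume (polaronLow (d := d) r) := by
  have h := isCoupling_fourier (measurableSet_le measurable_norm measurable_const)
    (memLp_two_restrict_norm_rpow_low hd r)
  simp_rw [← mul_assoc] at h
  exact h

theorem isCoupling_polaronHigh (hd : 1 ≤ d) {r : ℝ} (hr : 0 < r) (l : Fin d) :
    IsCoupling volume (fun z => polaronHigh (d := d) r z l) := by
  have h0 := memLp_two_restrict_norm_rpow_high hd hr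
  have h1 : MemLp (fun k : EuclideanSpace ℝ (Fin d) => (Complex.I * ((k l / ‖k‖ : ℝ) : ℂ))
      * ((‖k‖ ^ (-(((d : ℝ) + 1) / 2)) : ℝ) : ℂ)) 2 (volume.restrict {k | r < ‖k‖}) := by
    refine h0.of_le ?_ (Eventually.of_forall fun k => ?_)
    · refine AEStronglyMeasurable.mul (Measurable.aestronglyMeasurable ?_) h0.1
      exact (Complex.measurable_ofReal.comp
        (Measurable.div (by fun_prop) measurable_norm)).const_mul _
    · rw [norm_mul, norm_mul, Complex.norm_I, one_mul, Complex.norm_real, norm_div, norm_norm]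
      refine mul_le_of_le_one_left (norm_nonneg _) (div_le_one_of_le₀ ?_ (norm_nonneg _))
      exact PiLp.norm_apply_le k l
  have h := isCoupling_fourier (measurableSet_lt measurable_const measurable_norm) h1
  simp_rw [← mul_assoc] at h
  unfold polaronHigh
  simp_rw [← mul_assoc]
  exact h

end Polaron

/-! ### The three models -/

instance separableSpace_wave (d N : ℕ) : TopologicalSpace.SeparableSpace (Wave d N) := by
  have : Fact ((2 : ℝ≥0∞) ≠ ∞) := ⟨ENNReal.ofNat_ne_top⟩
  infer_instance

/-! ### The Nelson model -/

section Nelson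

variable {𝔥 : Type*} [NormedAddCommGroup 𝔥] [InnerProductSpace ℂ 𝔥] [CompleteSpace 𝔥]
variable {ω : Dispersion 𝔥} {σ : 𝔥 →ₗ.[ℂ] 𝔥} {d N : ℕ}

theorem isCoupling_nelsonPotential (hσ : IsPositiveSqrt σ ω.op)
    {lam : EuclideanSpace ℝ (Fin d) → 𝔥} (hlam : IsFormFactor σ lam) (j : Fin N) :
    IsCoupling volume (fun (z : ω.FieldSpace) (X : Config d N) =>
      nelsonPotential ω σ lam z (pos j X)) :=
  (isCoupling_pairing hσ hlam).comp (quasiMeasurePreserving_pos j)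

/-- The Nelson energy without the field energy. -/
def nelsonParticleEnergy (ω : Dispersion 𝔥) (σ : 𝔥 →ₗ.[ℂ] 𝔥) (W : Config d N → ℝ)
    (lam : EuclideanSpace ℝ (Fin d) → 𝔥) (z : ω.FieldSpace) (ψ : Wave d N) : ℝ :=
  freeForm W ψ + ∑ j, ∫ X, nelsonPotential ω σ lam z (pos j X) * ‖ψ X‖ ^ 2

variable {W : Config d N → ℝ} {lam : EuclideanSpace ℝ (Fin d) → 𝔥}

theorem isQuadraticEnergy_nelson (hW : IsPotential W) (hσ : IsPositiveSqrt σ ω.op)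
    (hlam : IsFormFactor σ lam) :
    IsQuadraticEnergy (formDomain W hW)
      (withFieldEnergy (nelsonParticleEnergy ω σ W lam))
      (nelsonEnergy ω σ W lam) where
  quadratic z := by
    refine ((isQuadraticOn_freeForm hW).add (IsQuadraticOn.sum _ fun j _ => ?_)).add
      ((IsQuadraticOn.norm_sq _).const_mul _)
    have ha := isCoupling_nelsonPotential (N := N) hσ hlam j
    exact ((IsLinearOn.id _).isQuadraticOn_re_inner (ha.isLinearOn_mulWave _ z)).congr
      fun ψ _ => ha.integral_mul_norm_sq z ψ
  eq_coe _ hψ _ := if_pos hψ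
  eq_top _ hψ _ := if_neg hψ

theorem isConvexQuadratic_nelson (hσ : IsPositiveSqrt σ ω.op) (hlam : IsFormFactor σ lam)
    (ψ : Wave d N) : IsConvexQuadratic (fun z => nelsonParticleEnergy ω σ W lam z ψ) := by
  refine (IsConvexQuadratic.const _).add (IsConvexQuadratic.sum _ fun j _ => ?_)
  have ha := isCoupling_nelsonPotential (N := N) hσ hlam j
  simpa [ha.integral_mul_norm_sq] using
    (ha.isBoundedRealLinear_mulWave ψ).isConvexQuadratic_re_inner 1 ψ

end Nelson

/-! ### The Fröhlich polaron -/

section Polaron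

variable {d N : ℕ}

/-- The polaron energy without the field energy. -/
def polaronParticleEnergy (W : Config d N → ℝ) (α r : ℝ) (z : PolaronField d) (ψ : Wave d N) : ℝ :=
  freeForm W ψ
    + Real.sqrt α * (∑ j, ((∫ X, polaronLow r z (pos j X) * ‖ψ X‖ ^ 2)
      - 2 * (∑ l, (∫ X, (starRingEnd ℂ) (ψ X) * (polaronHigh r z l (pos j X) : ℂ)
        * weakPartial (j, l) ψ X).re)))

theorem isCoupling_polaronLow_pos (hd : 1 ≤ d) (r : ℝ) (j : Fin N) :
    IsCoupling volume (fun z (X : Config d N) => polaronLow r z (pos j X)) :=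
  (isCoupling_polaronLow hd r).comp (quasiMeasurePreserving_pos j)

theorem isCoupling_polaronHigh_pos (hd : 1 ≤ d) {r : ℝ} (hr : 0 < r) (j : Fin N) (l : Fin d) :
    IsCoupling volume (fun z (X : Config d N) => polaronHigh r z l (pos j X)) :=
  (isCoupling_polaronHigh hd hr l).comp (quasiMeasurePreserving_pos j)

variable {W : Config d N → ℝ}

theorem isQuadraticEnergy_polaron (hW : IsPotential W) (hd : 1 ≤ d) (α : ℝ) {r : ℝ} (hr : 0 < r) :
    IsQuadraticEnergy (formDomain W hW)
      (withFieldEnergy (polaronParticleEnergy W α r)) (polaronEnergy W α r) where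
  quadratic z := by
    refine ((isQuadraticOn_freeForm hW).add (IsQuadraticOn.const_mul _
      (IsQuadraticOn.sum _ fun j _ => IsQuadraticOn.sub ?_ (IsQuadraticOn.const_mul _
        (IsQuadraticOn.sum _ fun l _ => ?_))))).add ((IsQuadraticOn.norm_sq _).const_mul _)
    · have ha := isCoupling_polaronLow_pos (N := N) hd r j
      exact ((IsLinearOn.id _).isQuadraticOn_re_inner (ha.isLinearOn_mulWave _ z)).congr
        fun ψ _ => ha.integral_mul_norm_sq z ψ
    · have ha := isCoupling_polaronHigh_pos (N := N) hd hr j l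
      exact ((ha.isLinearOn_mulWave _ z).isQuadraticOn_re_inner
        (isLinearOn_weakPartial hW (j, l))).congr
        fun ψ _ => congrArg Complex.re (ha.integral_conj_mul_mul z ψ (weakPartial (j, l) ψ))
  eq_coe _ hψ _ := if_pos hψ
  eq_top _ hψ _ := if_neg hψ

theorem isConvexQuadratic_polaron (hd : 1 ≤ d) (α : ℝ) {r : ℝ} (hr : 0 < r) (ψ : Wave d N) :
    IsConvexQuadratic (fun z => polaronParticleEnergy W α r z ψ) := by
  -- The factor `-2` is moved inside the sum: terms linear in `z` may carry any sign, whereas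
  -- `IsConvexQuadratic.const_mul` needs a nonnegative factor.
  have key : ∀ j : Fin N, IsConvexQuadratic (fun z => (∫ X, polaronLow r z (pos j X) * ‖ψ X‖ ^ 2)
      + ∑ l, -2 * (∫ X, (starRingEnd ℂ) (ψ X) * (polaronHigh r z l (pos j X) : ℂ)
        * weakPartial (j, l) ψ X).re) := by
    intro j
    refine IsConvexQuadratic.add ?_ (IsConvexQuadratic.sum _ fun l _ => ?_)
    · have ha := isCoupling_polaronLow_pos (N := N) hd r j
      simpa [ha.integral_mul_norm_sq] using
        (ha.isBoundedRealLinear_mulWave ψ).isConvexQuadratic_re_inner 1 ψ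
    · have ha := isCoupling_polaronHigh_pos (N := N) hd hr j l
      have h := (ha.isBoundedRealLinear_mulWave ψ).isConvexQuadratic_re_inner (-2)
        (weakPartial (j, l) ψ)
      refine (congrArg IsConvexQuadratic (funext fun z => ?_)).mp h
      rw [ha.integral_conj_mul_mul, ← RCLike.re_eq_complex_re, inner_re_symm]
  have h := (IsConvexQuadratic.const (freeForm W ψ)).add
    ((IsConvexQuadratic.sum Finset.univ fun j _ => key j).const_mul (Real.sqrt_nonneg α))
  refine (congrArg IsConvexQuadratic (funext fun z => ?_)).mp h
  simp only [polaronParticleEnergy, Finset.mul_sum, neg_mul, sub_eq_add_neg,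
    Finset.sum_neg_distrib]

end Polaron

/-! ### The Pauli-Fierz model -/

section PauliFierz

variable {𝔥 : Type*} [NormedAddCommGroup 𝔥] [InnerProductSpace ℂ 𝔥] [CompleteSpace 𝔥]
variable {ω : Dispersion 𝔥} {σ : 𝔥 →ₗ.[ℂ] 𝔥} {N : ℕ}

theorem isCoupling_vectorPotential (hσ : IsPositiveSqrt σ ω.op)
    {lam : Fin 3 → EuclideanSpace ℝ (Fin 3) → 𝔥} (l : Fin 3) (hlam : IsFormFactor σ (lam l))
    (j : Fin N) :
    IsCoupling volume (fun (z : ω.FieldSpace) (X : Config 3 N) =>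
      vectorPotential ω σ lam z l (pos j X)) :=
  (isCoupling_pairing hσ hlam).comp (quasiMeasurePreserving_pos j)

/-- The Pauli-Fierz energy without the field energy. -/
def pauliFierzParticleEnergy (ω : Dispersion 𝔥) (σ : 𝔥 →ₗ.[ℂ] 𝔥) (W : Config 3 N → ℝ)
    (m : Fin N → ℝ) (e : ℝ) (lam : Fin N → Fin 3 → EuclideanSpace ℝ (Fin 3) → 𝔥)
    (z : ω.FieldSpace) (ψ : Wave 3 N) : ℝ :=
  (∑ j, 1 / (2 * m j) * (∑ l, (∫ X,
      ‖-Complex.I * weakPartial (j, l) ψ X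
        + ((e * vectorPotential ω σ (lam j) z l (pos j X) : ℝ) : ℂ) * ψ X‖ ^ 2)))
    + (∫ X, W X * ‖ψ X‖ ^ 2)

theorem integral_kinetic_eq_norm_sq {d : ℕ} {K : Type*} [NormedAddCommGroup K]
    [InnerProductSpace ℂ K] {a : K → Config d N → ℝ} (ha : IsCoupling volume a) (e : ℝ) (z : K)
    (ψ g : Wave d N) :
    ∫ X, ‖-Complex.I * g X + ((e * a z X : ℝ) : ℂ) * ψ X‖ ^ 2
      = ‖(-Complex.I) • g + (e : ℂ) • ha.mulWave z ψ‖ ^ 2 := by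
  rw [← ha.integral_norm_sq_add]
  simp only [Complex.ofReal_mul, mul_assoc]

variable {W : Config 3 N → ℝ} {m : Fin N → ℝ}
  {lam : Fin N → Fin 3 → EuclideanSpace ℝ (Fin 3) → 𝔥}

theorem isQuadraticEnergy_pauliFierz (hW : IsPotential W) (hσ : IsPositiveSqrt σ ω.op) (e : ℝ)
    (hlam : ∀ j l, IsFormFactor σ (lam j l)) :
    IsQuadraticEnergy (formDomain W hW)
      (withFieldEnergy (pauliFierzParticleEnergy ω σ W m e lam))
      (pauliFierzEnergy ω σ W m e lam) where
  quadratic z := by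
    refine ((IsQuadraticOn.sum _ fun j _ => IsQuadraticOn.const_mul _
      (IsQuadraticOn.sum _ fun l _ => ?_)).add (isQuadraticOn_potential hW)).add
        ((IsQuadraticOn.norm_sq _).const_mul _)
    have ha := isCoupling_vectorPotential (N := N) hσ l (hlam j l) j
    exact ((isLinearOn_weakPartial hW (j, l)).smul_add_smul (ha.isLinearOn_mulWave _ z)
      (-Complex.I) e).isQuadraticOn_norm_sq.congr
        fun ψ _ => integral_kinetic_eq_norm_sq ha e z ψ _
  eq_coe _ hψ _ := if_pos hψ
  eq_top _ hψ _ := if_neg hψ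

/-- The kinetic term is a squared norm of an affine function of `z`. Positive masses keep its
quadratic part nonnegative. -/
theorem isConvexQuadratic_pauliFierz (hσ : IsPositiveSqrt σ ω.op) (hm : ∀ j, 0 < m j) (e : ℝ)
    (hlam : ∀ j l, IsFormFactor σ (lam j l)) (ψ : Wave 3 N) :
    IsConvexQuadratic (fun z => pauliFierzParticleEnergy ω σ W m e lam z ψ) := by
  refine (IsConvexQuadratic.sum _ fun j _ => IsConvexQuadratic.const_mul
    (one_div_nonneg.2 (mul_nonneg zero_le_two (hm j).le))
    (IsConvexQuadratic.sum _ fun l _ => ?_)).add (IsConvexQuadratic.const _)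
  have ha := isCoupling_vectorPotential (N := N) hσ l (hlam j l) j
  have h := (ha.isBoundedRealLinear_mulWave ψ).isConvexQuadratic_norm_sq_add e
    ((-Complex.I) • weakPartial (j, l) ψ)
  exact (congrArg IsConvexQuadratic (funext fun z =>
    (integral_kinetic_eq_norm_sq ha e z ψ (weakPartial (j, l) ψ)).symm)).mp h

end PauliFierz

end QuasiClassical

end

open QuasiClassical in
theorem mainTheorem10 {𝔥 : Type*} [NormedAddCommGroup 𝔥] [InnerProductSpace ℂ 𝔥]
    [CompleteSpace 𝔥] [TopologicalSpace.SeparableSpace 𝔥]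
    (ω : Dispersion 𝔥) (σ : 𝔥 →ₗ.[ℂ] 𝔥) (hσ : IsPositiveSqrt σ ω.op)
    (d N : ℕ) (hd : 1 ≤ d ∧ d ≤ 3) (hN : 1 ≤ N) :
    -- the Nelson model
    (∀ (W : Config d N → ℝ) (lam : EuclideanSpace ℝ (Fin d) → 𝔥),
      IsPotential W → IsFormFactor σ lam →
      [∃ p, IsQcMinimizer (nelsonEnergy ω σ W lam) p,
        ∃ ψ, IsPekarMinimizer (pekarInf (nelsonEnergy ω σ W lam)) ψ,
        ∃ m, IsSvmMinimizer (nelsonEnergy ω σ W lam) m,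
        ∃ p, IsPmMinimizer (nelsonEnergy ω σ W lam) p].TFAE ∧
      ∀ m, IsSvmMinimizer (nelsonEnergy ω σ W lam) m →
        IsConcentratedOnMinimizers (nelsonEnergy ω σ W lam) m) ∧
    -- the Fröhlich polaron
    (∀ (W : Config d N → ℝ) (α r : ℝ), IsPotential W → 0 < α → 0 < r →
      [∃ p, IsQcMinimizer (polaronEnergy W α r) p,
        ∃ ψ, IsPekarMinimizer (pekarInf (polaronEnergy W α r)) ψ,
        ∃ m, IsSvmMinimizer (polaronEnergy W α r) m,
        ∃ p, IsPmMinimizer (polaronEnergy W α r) p].TFAE ∧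
      ∀ m, IsSvmMinimizer (polaronEnergy W α r) m →
        IsConcentratedOnMinimizers (polaronEnergy W α r) m) ∧
    -- the Pauli-Fierz model, in three dimensions
    (∀ (W : Config 3 N → ℝ) (m : Fin N → ℝ) (e : ℝ)
      (lam : Fin N → Fin 3 → EuclideanSpace ℝ (Fin 3) → 𝔥),
      IsPotential W → (∀ j, 0 < m j) → (∀ j l, IsFormFactor σ (lam j l)) →
      [∃ p, IsQcMinimizer (pauliFierzEnergy ω σ W m e lam) p,
        ∃ ψ, IsPekarMinimizer (pekarCritical (pauliFierzEnergy ω σ W m e lam)) ψ,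
        ∃ 𝔪, IsSvmMinimizer (pauliFierzEnergy ω σ W m e lam) 𝔪,
        ∃ p, IsPmMinimizer (pauliFierzEnergy ω σ W m e lam) p].TFAE ∧
      ∀ 𝔪, IsSvmMinimizer (pauliFierzEnergy ω σ W m e lam) 𝔪 →
        IsConcentratedOnMinimizers (pauliFierzEnergy ω σ W m e lam) 𝔪) := by
  refine ⟨fun W lam hW hlam => ?_, fun W α r hW _ hr => ?_, fun W m e lam hW hm hlam => ?_⟩
  · have hE := isQuadraticEnergy_nelson hW hσ hlam
    exact ⟨tfae_exists_minimizer_pekarInf hE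
      fun ψ _ => isConvexQuadratic_nelson hσ hlam ψ, fun _ h => isConcentratedOnMinimizers hE h⟩
  · have hE := isQuadraticEnergy_polaron hW hd.1 α hr
    exact ⟨tfae_exists_minimizer_pekarInf hE
      fun ψ _ => isConvexQuadratic_polaron hd.1 α hr ψ, fun _ h => isConcentratedOnMinimizers hE h⟩
  · have hE := isQuadraticEnergy_pauliFierz (m := m) hW hσ e hlam
    exact ⟨tfae_exists_minimizer_pekarCritical hE
      fun ψ _ => isConvexQuadratic_pauliFierz hσ hm e hlam ψ,
      fun _ h => isConcentratedOnMinimizers hE h⟩
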